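/- Let $A:[0,\infty)\to\mathbb R^{d\times d}$ be continuous and $H:[0,\infty)\to\mathbb R^{s\times d}$ measurable, both bounded: $\sup_{t\ge0}\sup_{\|x\|=1}\|A(t)x\|<\infty$ and $\sup_{t\ge0}\sup_{\|x\|=1}\|H(t)x\|<\infty$. For $v\in\mathbb R^d$ let $\xi(t;v)$ solve $\dot\xi=A(t)\xi$, $\xi(0)=v$, and put $\lambda(v)=\limsup_{t\to\infty}\frac1t\log\|\xi(t;v)\|$ (with $\lambda(0)=-\infty$). Let $\lambda_1\ge\dots\ge\lambda_d$ be the Lyapunov exponents, i.e. the values of $\lambda$ on $\mathbb R^d\setminus\{0\}$ counted with multiplicity, so that $\#\{i:\lambda_i\le c\}=\dim\{v:\lambda(v)\le c\}$ for every $c\in\mathbb R$, and let $k$ be the number of indices $i$ with $\lambda_i\ge 0$. Let $\mathbb Q(t)\in\mathbb R^{d\times d}$ be orthogonal and solve the continuous QR equation $\dot{\mathbb Q}=\mathbb Q S$, where $S$ is skew-symmetric with $S_{ij}=(\mathbb Q^\top A\mathbb Q)_{ij}$ for $i>j$, so that $B=\mathbb Q^\top A\mathbb Q-S$ is upper triangular.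 Assume forward regularity: $\lim_{t\to\infty}\frac1t\int_0^tB_{ii}(\tau)\,d\tau$ exists for $i=1,\dots,d$. Let $Q(t)\in\mathbb R^{d\times k}$ consist of the first $k$ columns $Q_1,\dots,Q_k$ of $\mathbb Q(t)$; equivalently, $Q$ solves $\dot Q=(I-QQ^\top)AQ+Q\tilde S$ with $\tilde S$ skew-symmetric and $Q^\top AQ-\tilde S$ upper triangular. Assume that these columns belong to the non-stable directions, in the sense that $\lambda(v)\ge0$ for every non-zero $v$ in the span of the columns of $Q(0)$. Let $\tilde Q(t)\tilde R(t)=H^\top(t)H(t)Q(t)$ be the thin QR factorisation produced by the Gram–Schmidt process ($\tilde R\in\mathbb R^{k\times k}$ upper triangular, $\tilde R_{jj}\ge0$, and the $j$th column of $\tilde Q\in\mathbb R^{d\times k}$ is $0$ when $\tilde R_{jj}=0$). Call $(A,H)$ detectable if $\limsup_{t\to\infty}\frac1t\int_0^t\tilde R_{jj}(\tau)\,d\tau>0$ for every $j\le k$ with $\lim_{t\to\infty}\frac1t\int_0^tB_{jj}(\tau)\,d\tau\ge0$. For $p>0$ let $L=p\,Q\tilde Q^\top H^\top$. Let $z$ and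 $x$ solve (in the sense of Carathéodory, i.e. as integral equations) $$\dot z=A(t)z,\quad z(0)=v,\qquad y=H(t)z,\qquad \dot x=A(t)x+L(t)(y(t)-H(t)x),\quad x(0)=0,$$ and say that the error $\xi=z-x$ decays exponentially if there are $C,a>0$ such that $\|\xi(t)\|\le Ce^{-at}\|\xi(0)\|$ for all $t\ge0$ and all $v\in\mathbb R^d$. Then: 1. if the error decays exponentially for some $p>0$, then $(A,H)$ is detectable; 2. if the time averages $\frac1t\int_0^t\tilde R_{jj}(\tau)\,d\tau$ converge as $t\to\infty$ for $j=1,\dots,k$, then there exists $p>0$ for which the error decays exponentially if and only if $(A,H)$ is detectable. -/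

import Mathlib

open Filter Set MeasureTheory Matrix
open scoped Topology

noncomputable section

namespace LinearObserver

/-- Euclidean norm of a coordinate vector. -/
def enorm2 {n : ℕ} (v : Fin n → ℝ) : ℝ := ‖WithLp.toLp 2 v‖

/-- `sup_{t ≥ 0} sup_{‖x‖ = 1} ‖M(t) x‖ < ∞`. -/
def BoundedInTime {m n : ℕ} (M : ℝ → Matrix (Fin m) (Fin n) ℝ) : Prop :=
  ∃ K : ℝ, ∀ t, 0 ≤ t → ∀ x : Fin n → ℝ, enorm2 x = 1 → enorm2 (M t *ᵥ x) ≤ K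

/-- The time average `(1/t) ∫₀ᵗ g(s) ds`. -/
def timeAverage (g : ℝ → ℝ) (t : ℝ) : ℝ := (1 / t) * ∫ s in (0 : ℝ)..t, g s

/-- Forward solution on `[0, ∞)` of `ẋ = F(t, x)`, `x(0) = x₀`, in integrated (Carathéodory) form.
The integrated form is used because the thin QR factor of `Hᵀ H Q`, and with it the gain, may jump
in time where the rank drops. -/
def IsSolution {n : ℕ} (F : ℝ → (Fin n → ℝ) → (Fin n → ℝ)) (x₀ : Fin n → ℝ)
    (x : ℝ → Fin n → ℝ) : Prop :=
  ∀ t, 0 ≤ t → IntervalIntegrable (fun s => F s (x s)) volume 0 t ∧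
    x t = x₀ + ∫ s in (0 : ℝ)..t, F s (x s)

/-- `Φ` is the solution of `Ẋ = A(t) X`, `X(0) = I`, on `[0, ∞)`. -/
def IsFlow {d : ℕ} (A Φ : ℝ → Matrix (Fin d) (Fin d) ℝ) : Prop :=
  Φ 0 = 1 ∧ ∀ t, 0 ≤ t → ∀ i j,
    HasDerivWithinAt (fun τ => Φ τ i j) ((A t * Φ t) i j) (Ici 0) t

open Classical in
/-- `λ(v) = limsup_{t → ∞} (1/t) log ‖Φ(t) v‖`, with `λ(0) = -∞`. -/
def lyapunovExponent {d : ℕ} (Φ : ℝ → Matrix (Fin d) (Fin d) ℝ) (v : Fin d → ℝ) : EReal :=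
  if v = 0 then ⊥
  else limsup (fun t : ℝ => ((1 / t * Real.log (enorm2 (Φ t *ᵥ v)) : ℝ) : EReal)) atTop

/-- `lam 0 ≥ lam 1 ≥ …` are the `d` values of the Lyapunov exponent function, counted with
multiplicity: the number of them that are at most `c` is the dimension of the member
`{v | λ(v) ≤ c}` of the filtration (this set is a linear subspace, hence equal to its span). -/
def IsLyapunovSpectrum {d : ℕ} (Φ : ℝ → Matrix (Fin d) (Fin d) ℝ) (lam : Fin d → ℝ) : Prop :=
  Antitone lam ∧ ∀ c : ℝ, (Finset.univ.filter fun i => lam i ≤ c).card =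
    Module.finrank ℝ (Submodule.span ℝ {v : Fin d → ℝ | lyapunovExponent Φ v ≤ (c : EReal)})

/-- The skew-symmetric matrix with the same entries as `M` below the diagonal. -/
def skewOfLower {k : ℕ} (M : Matrix (Fin k) (Fin k) ℝ) : Matrix (Fin k) (Fin k) ℝ :=
  Matrix.of fun i j => if j < i then M i j else if i < j then -M j i else 0

/-- Right-hand side of the continuous QR equation `Q̇ = (I - Q Qᵀ) A Q + Q S`, where `S` is
skew-symmetric and makes `Qᵀ A Q - S` upper triangular. -/
def qrField {d k : ℕ} (A : Matrix (Fin d) (Fin d) ℝ) (Q : Matrix (Fin d) (Fin k) ℝ) :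
    Matrix (Fin d) (Fin k) ℝ :=
  (1 - Q * Qᵀ) * A * Q + Q * skewOfLower (Qᵀ * A * Q)

/-- `Q` has orthonormal columns and solves the continuous QR equation on `[0, ∞)`.
For `k = d` the matrix `Q` is orthogonal and the equation reads `Q̇ = Q S`. -/
def IsContinuousQR {d k : ℕ} (A : ℝ → Matrix (Fin d) (Fin d) ℝ)
    (Q : ℝ → Matrix (Fin d) (Fin k) ℝ) : Prop :=
  ∀ t, 0 ≤ t → (Q t)ᵀ * Q t = 1 ∧ ∀ i j,
    HasDerivWithinAt (fun τ => Q τ i j) (qrField (A t) (Q t) i j) (Ici 0) t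

/-- The upper triangular coefficient matrix `B = Qᵀ A Q - S` of `Ṙ = B R`. -/
def coeffB {d k : ℕ} (A : ℝ → Matrix (Fin d) (Fin d) ℝ) (Q : ℝ → Matrix (Fin d) (Fin k) ℝ)
    (t : ℝ) : Matrix (Fin k) (Fin k) ℝ :=
  (Q t)ᵀ * A t * Q t - skewOfLower ((Q t)ᵀ * A t * Q t)

/-- Forward regularity: the time averages of all the diagonal entries of `B` converge. -/
def ForwardRegular {d : ℕ} (A QQ : ℝ → Matrix (Fin d) (Fin d) ℝ) : Prop :=
  ∀ i, ∃ l : ℝ, Tendsto (timeAverage fun s => coeffB A QQ s i i) atTop (𝓝 l)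

/-- The factor `Q̃` of the thin QR factorisation of `Y`: the columns of `Y` are orthonormalised by
the Gram-Schmidt process; a column that depends linearly on the preceding ones gives `0`. -/
def thinQ {d k : ℕ} (Y : Matrix (Fin d) (Fin k) ℝ) : Matrix (Fin d) (Fin k) ℝ :=
  Matrix.of fun i j =>
    InnerProductSpace.gramSchmidtNormed ℝ
      (fun l : Fin k => (WithLp.toLp 2 (fun m => Y m l) : EuclideanSpace ℝ (Fin d))) j i

/-- The upper triangular factor `R̃` of the thin QR factorisation `Y = Q̃ R̃`. -/
def thinR {d k : ℕ} (Y : Matrix (Fin d) (Fin k) ℝ) : Matrix (Fin k) (Fin k) ℝ :=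
  (thinQ Y)ᵀ * Y

/-- The matrix `Hᵀ H Q` at time `t`. -/
def observedBasis {d k s : ℕ} (H : ℝ → Matrix (Fin s) (Fin d) ℝ)
    (Q : ℝ → Matrix (Fin d) (Fin k) ℝ) (t : ℝ) : Matrix (Fin d) (Fin k) ℝ :=
  (H t)ᵀ * H t * Q t

/-- The time average of `R̃_jj`, where `Q̃ R̃ = Hᵀ H Q` is the thin QR factorisation. -/
def observability {d k s : ℕ} (H : ℝ → Matrix (Fin s) (Fin d) ℝ)
    (Q : ℝ → Matrix (Fin d) (Fin k) ℝ) (j : Fin k) : ℝ → ℝ :=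
  timeAverage fun τ => thinR (observedBasis H Q τ) j j

/-- `(A, H)` is detectable in the direction `Q_j`. -/
def DetectableInDirection {d k s : ℕ} (H : ℝ → Matrix (Fin s) (Fin d) ℝ)
    (Q : ℝ → Matrix (Fin d) (Fin k) ℝ) (j : Fin k) : Prop :=
  0 < limsup (observability H Q j) atTop

/-- `(A, H)` is detectable: it is detectable in every direction `Q_j` of the non-stable tangent
space, i.e. with `lim (1/t) ∫₀ᵗ B_jj ≥ 0`. -/
def Detectable {d k s : ℕ} (A : ℝ → Matrix (Fin d) (Fin d) ℝ) (H : ℝ → Matrix (Fin s) (Fin d) ℝ)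
    (Q : ℝ → Matrix (Fin d) (Fin k) ℝ) : Prop :=
  ∀ j : Fin k,
    (∃ l : ℝ, 0 ≤ l ∧ Tendsto (timeAverage fun τ => coeffB A Q τ j j) atTop (𝓝 l)) →
      DetectableInDirection H Q j

/-- The gain `L = p Q Q̃ᵀ Hᵀ`. -/
def gain {d k s : ℕ} (H : ℝ → Matrix (Fin s) (Fin d) ℝ) (Q : ℝ → Matrix (Fin d) (Fin k) ℝ)
    (p : ℝ) (t : ℝ) : Matrix (Fin d) (Fin s) ℝ :=
  p • (Q t * (thinQ (observedBasis H Q t))ᵀ * (H t)ᵀ)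

/-- The estimation error `ξ = z - x` decays exponentially, where `ż = A z`, `z(0) = v`, is the
signal with noise-free output `y = H z`, and `ẋ = A x + L (y - H x)`, `x(0) = 0`, is the observer:
`‖ξ(t)‖ ≤ C e^{-a t} ‖ξ(0)‖` with `C, a > 0` independent of `v`. -/
def ErrorDecaysExponentially {d s : ℕ} (A : ℝ → Matrix (Fin d) (Fin d) ℝ)
    (H : ℝ → Matrix (Fin s) (Fin d) ℝ) (L : ℝ → Matrix (Fin d) (Fin s) ℝ) : Prop :=
  ∃ C > 0, ∃ a > 0, ∀ (v : Fin d → ℝ) (z x : ℝ → Fin d → ℝ),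
    IsSolution (fun t w => A t *ᵥ w) v z →
    IsSolution (fun t w => A t *ᵥ w + L t *ᵥ (H t *ᵥ z t - H t *ᵥ w)) 0 x →
    ∀ t, 0 ≤ t → enorm2 (z t - x t) ≤ C * Real.exp (-a * t) * enorm2 (z 0 - x 0)

end LinearObserver

end

/-! The error solves `ξ' = (A - L H) ξ`. In the orthonormal frame `QQ`, the coordinates `η = QQᵀ ξ`
have the same norm and satisfy `η' = T η` with `T = B - p (QQᵀ Q) Q̃ᵀ Hᵀ H QQ`. Since `QQᵀ Q`
consists of the first `k` columns of the identity, the gain leaves the last `d - k` rows of `B`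
untouched and turns the leading `k × k` block into `B - p R̃`. Hence `T` is upper triangular, and
its diagonal is `B_jj - p R̃_jj` for `j < k` and `B_ii` for `i ≥ k`.

Necessity (`detectable_of_decay`): the solution with `η(0) = e_j` has `j`th coordinate `exp ∫ (B_jj
- p R̃_jj)`. If this is at most `C e^{-a t}` while `B_jj` has non-negative mean, the averages of
`R̃_jj` are eventually at least `a / (2p)`.

Sufficiency (`decay_of_diag_neg`): a bounded triangular system whose diagonal entries have negative
means is exponentially stable, by solving from the last coordinate upwards
(`UpperTriangular.exists_decay`). For `j < k` the mean is `b_j - p r_j`, negative once `p` is large.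
For `i ≥ k` negativity is `tail_average_neg`: the stable subspace has dimension `d - k` and meets
the span of `Q(0)` trivially, so it contains a vector whose last non-zero frame coordinate is the
`i`th, and that coordinate is `exp ∫ B_ii`. -/

noncomputable section

namespace LinearObserver

/-! ### Indefinite integrals on the half-line and scalar linear equations. -/

/-- `g` is integrable on every interval `[0, t]`. -/
def LocInt (g : ℝ → ℝ) : Prop := ∀ t, 0 ≤ t → IntervalIntegrable g volume 0 t

/-- `f` is on `[0, ∞)` an indefinite integral of the locally integrable function `g`. -/
def HasPrimitive (f g : ℝ → ℝ) : Prop :=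
  ∀ t, 0 ≤ t → IntervalIntegrable g volume 0 t ∧ f t = f 0 + ∫ s in (0 : ℝ)..t, g s

theorem absolutelyContinuousOnInterval_congr {f g : ℝ → ℝ} {a b : ℝ}
    (hf : AbsolutelyContinuousOnInterval f a b) (h : ∀ x ∈ uIcc a b, f x = g x) :
    AbsolutelyContinuousOnInterval g a b := by
  rw [absolutelyContinuousOnInterval_iff] at hf ⊢
  intro ε hε
  obtain ⟨δ, hδ, H⟩ := hf ε hε
  refine ⟨δ, hδ, fun E hE hlt => ?_⟩
  have h2 := H E hE hlt
  convert h2 using 2 with i hi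
  have := hE.1 i hi
  rw [h _ this.1, h _ this.2]

/-- The range of `f` lies in some `[-M, M]`, where `exp` is Lipschitz. Dividing by `K + 1` avoids
the case `K = 0`. -/
theorem absolutelyContinuousOnInterval_exp {f : ℝ → ℝ} {a b : ℝ}
    (hf : AbsolutelyContinuousOnInterval f a b) :
    AbsolutelyContinuousOnInterval (fun t => Real.exp (f t)) a b := by
  obtain ⟨M, hM⟩ := hf.exists_bound
  obtain ⟨K, hK⟩ := (Real.contDiff_exp (n := 1)).contDiffOn.exists_lipschitzOnWith (by decide)
    (convex_Icc (-M) M) isCompact_Icc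
  rw [absolutelyContinuousOnInterval_iff] at hf ⊢
  intro ε hε
  obtain ⟨δ, hδ, H⟩ := hf (ε / (K + 1)) (by positivity)
  refine ⟨δ, hδ, fun E hE hlt => ?_⟩
  have h2 := H E hE hlt
  rw [lt_div_iff₀ (by positivity)] at h2
  refine lt_of_le_of_lt ?_ h2
  rw [Finset.sum_mul]
  refine Finset.sum_le_sum fun i hi => ?_
  have := hE.1 i hi
  have e1 := abs_le.1 (hM _ this.1)
  have e2 := abs_le.1 (hM _ this.2)
  refine (hK.dist_le_mul _ e1 _ e2).trans ?_
  nlinarith [dist_nonneg (x := f (E.2 i).1) (y := f (E.2 i).2)]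

/-- Lebesgue's fundamental theorem of calculus. It reduces the product and chain rules for merely
integrable derivatives to pointwise rules almost everywhere. The point `0` is left out because
nothing is known about `f` on the negative axis. -/
theorem hasPrimitive_iff {f g : ℝ → ℝ} : HasPrimitive f g ↔
    (∀ T, 0 ≤ T → AbsolutelyContinuousOnInterval f 0 T) ∧
      ∀ᵐ x : ℝ, 0 < x → HasDerivAt f (g x) x := by
  constructor
  · intro h
    refine ⟨fun T hT => ?_, ?_⟩
    · have h1 := (h T hT).1.absolutelyContinuousOnInterval_intervalIntegral (c := 0) (by simp)
      have h2 : AbsolutelyContinuousOnInterval (fun _ : ℝ => f 0) 0 T :=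
        contDiffOn_const.absolutelyContinuousOnInterval
      refine absolutelyContinuousOnInterval_congr (h2.add h1) fun x hx => ?_
      rw [uIcc_of_le hT] at hx
      exact (h x hx.1).2.symm
    · have : ∀ n : ℕ, ∀ᵐ x : ℝ, x ∈ uIcc (0 : ℝ) n →
          HasDerivAt (fun y => ∫ s in (0 : ℝ)..y, g s) (g x) x := by
        intro n
        filter_upwards [(h n (by positivity)).1.ae_hasDerivAt_integral] with x hx hxx
        exact hx hxx 0 (by simp)
      filter_upwards [ae_all_iff.2 this] with x hx hpos
      obtain ⟨n, hn⟩ := exists_nat_ge x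
      have h1 := (hx n (by rw [uIcc_of_le (by positivity)]; exact ⟨hpos.le, hn⟩)).const_add (f 0)
      refine h1.congr_of_eventuallyEq ?_
      filter_upwards [lt_mem_nhds hpos] with y hy
      exact (h y hy.le).2
  · rintro ⟨hac, hd⟩ t ht
    have hae : (deriv f) =ᵐ[volume.restrict (uIoc 0 t)] g := by
      rw [EventuallyEq, ae_restrict_iff' measurableSet_uIoc]
      filter_upwards [hd] with x hx hxx
      rw [uIoc_of_le ht] at hxx
      exact (hx hxx.1).deriv
    refine ⟨(hac t ht).intervalIntegrable_deriv.congr_ae hae, ?_⟩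
    have h1 := (hac t ht).integral_deriv_eq_sub
    rw [intervalIntegral.integral_congr_ae_restrict hae] at h1
    linarith

theorem HasPrimitive.mul {f g f' g' : ℝ → ℝ} (hf : HasPrimitive f f') (hg : HasPrimitive g g') :
    HasPrimitive (fun t => f t * g t) (fun t => f' t * g t + f t * g' t) := by
  rw [hasPrimitive_iff] at *
  refine ⟨fun T hT => (hf.1 T hT).mul (hg.1 T hT), ?_⟩
  filter_upwards [hf.2, hg.2] with x h1 h2 hx
  exact (h1 hx).mul (h2 hx)

theorem HasPrimitive.exp {f f' : ℝ → ℝ} (hf : HasPrimitive f f') :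
    HasPrimitive (fun t => Real.exp (f t)) (fun t => Real.exp (f t) * f' t) := by
  rw [hasPrimitive_iff] at *
  refine ⟨fun T hT => absolutelyContinuousOnInterval_exp (hf.1 T hT), ?_⟩
  filter_upwards [hf.2] with x h1 hx
  exact (h1 hx).exp

theorem HasPrimitive.locInt {f g : ℝ → ℝ} (h : HasPrimitive f g) : LocInt g :=
  fun t ht => (h t ht).1

theorem HasPrimitive.continuousOn {f g : ℝ → ℝ} (h : HasPrimitive f g) {T : ℝ} (hT : 0 ≤ T) :
    ContinuousOn f (uIcc 0 T) := ((hasPrimitive_iff.1 h).1 T hT).continuousOn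

theorem LocInt.hasPrimitive {g : ℝ → ℝ} (h : LocInt g) (c : ℝ) :
    HasPrimitive (fun t => c + ∫ s in (0 : ℝ)..t, g s) g :=
  fun t ht => ⟨h t ht, by simp⟩

theorem LocInt.congr {g g' : ℝ → ℝ} (h : LocInt g) (e : ∀ t, 0 ≤ t → g t = g' t) : LocInt g' := by
  intro t ht
  refine (h t ht).congr fun x hx => e x ?_
  rw [uIoc_of_le ht] at hx
  exact hx.1.le

theorem integral_congr_of_nonneg {g g' : ℝ → ℝ} (e : ∀ t, 0 ≤ t → g t = g' t) {t : ℝ}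
    (ht : 0 ≤ t) : ∫ s in (0 : ℝ)..t, g s = ∫ s in (0 : ℝ)..t, g' s := by
  refine intervalIntegral.integral_congr fun x hx => e x ?_
  rw [uIcc_of_le ht] at hx
  exact hx.1

theorem HasPrimitive.congr {f g f' g' : ℝ → ℝ} (h : HasPrimitive f f')
    (e : ∀ t, 0 ≤ t → f t = g t) (e' : ∀ t, 0 ≤ t → f' t = g' t) : HasPrimitive g g' := by
  intro t ht
  refine ⟨h.locInt.congr e' t ht, ?_⟩
  rw [← e t ht, ← e 0 le_rfl, ← integral_congr_of_nonneg e' ht]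
  exact (h t ht).2

theorem LocInt.sum {ι : Type*} (s : Finset ι) {g : ι → ℝ → ℝ} (h : ∀ i ∈ s, LocInt (g i)) :
    LocInt fun t => ∑ i ∈ s, g i t := by
  intro t ht
  have e : (fun t => ∑ i ∈ s, g i t) = ∑ i ∈ s, g i := by
    ext x
    simp
  rw [e]
  exact IntervalIntegrable.sum s fun i hi => h i hi t ht

theorem HasPrimitive.sum {ι : Type*} (s : Finset ι) {f g : ι → ℝ → ℝ}
    (h : ∀ i ∈ s, HasPrimitive (f i) (g i)) :
    HasPrimitive (fun t => ∑ i ∈ s, f i t) (fun t => ∑ i ∈ s, g i t) := by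
  intro t ht
  constructor
  · exact LocInt.sum s (fun i hi => (h i hi).locInt) t ht
  · rw [intervalIntegral.integral_finsetSum fun i hi => (h i hi t ht).1, ← Finset.sum_add_distrib]
    exact Finset.sum_congr rfl fun i hi => (h i hi t ht).2

theorem HasPrimitive.sub {f g f' g' : ℝ → ℝ} (hf : HasPrimitive f f') (hg : HasPrimitive g g') :
    HasPrimitive (fun t => f t - g t) (fun t => f' t - g' t) := by
  intro t ht
  refine ⟨(hf t ht).1.sub (hg t ht).1, ?_⟩
  rw [intervalIntegral.integral_sub (hf t ht).1 (hg t ht).1]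
  linarith [(hf t ht).2, (hg t ht).2]

theorem HasPrimitive.of_hasDerivWithinAt {f f' : ℝ → ℝ}
    (hf : ∀ t, 0 ≤ t → HasDerivWithinAt f (f' t) (Ici 0) t) (hc : ContinuousOn f' (Ici 0)) :
    HasPrimitive f f' := by
  intro t ht
  have hsub : uIcc 0 t ⊆ Ici 0 := by
    rw [uIcc_of_le ht]; exact fun x hx => hx.1
  have hi : IntervalIntegrable f' volume 0 t := (hc.mono hsub).intervalIntegrable
  refine ⟨hi, ?_⟩
  have := intervalIntegral.integral_eq_sub_of_hasDerivAt_of_le ht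
    (f := f) (f' := f') (fun x hx => ((hf x hx.1).continuousWithinAt).mono fun y hy => hy.1)
    (fun x hx => (hf x hx.1.le).hasDerivAt (Ici_mem_nhds hx.1)) hi
  linarith

theorem LocInt.mul_continuousOn {f g : ℝ → ℝ} (hf : LocInt f)
    (hg : ∀ T, 0 ≤ T → ContinuousOn g (uIcc 0 T)) : LocInt fun t => f t * g t :=
  fun t ht => (hf t ht).mul_continuousOn (hg t ht)

/-- Integrating factor: `ḟ = c f + g` gives `(f e^{-∫c})˙ = g e^{-∫c}`. -/
theorem HasPrimitive.mul_exp_neg {f c g : ℝ → ℝ} (hc : LocInt c)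
    (hf : HasPrimitive f fun t => c t * f t + g t) :
    HasPrimitive (fun t => f t * Real.exp (-∫ s in (0 : ℝ)..t, c s))
      (fun t => g t * Real.exp (-∫ s in (0 : ℝ)..t, c s)) := by
  have h0 : HasPrimitive (fun t => -∫ s in (0 : ℝ)..t, c s) (fun t => -c t) := by
    intro t ht
    exact ⟨(hc t ht).neg, by simp⟩
  refine (hf.mul h0.exp).congr (fun _ _ => rfl) fun t _ => ?_
  ring

/-- Variation of constants: a solution of `ḟ = c f + g`, `f(0) = a`. -/
theorem exists_hasPrimitive_linear {c g : ℝ → ℝ} (hc : LocInt c) (hg : LocInt g) (a : ℝ) :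
    ∃ f : ℝ → ℝ, f 0 = a ∧ HasPrimitive f fun t => c t * f t + g t := by
  have h1 : HasPrimitive (fun t => ∫ s in (0 : ℝ)..t, c s) c := by
    simpa using hc.hasPrimitive 0
  have h0 : HasPrimitive (fun t => -∫ s in (0 : ℝ)..t, c s) (fun t => -c t) := by
    intro t ht
    exact ⟨(hc t ht).neg, by simp⟩
  have h2 := (hg.mul_continuousOn fun T hT => h0.exp.continuousOn hT).hasPrimitive a
  refine ⟨_, ?_, (h1.exp.mul h2).congr (fun _ _ => rfl) fun t _ => ?_⟩
  · simp
  · have : Real.exp (∫ s in (0 : ℝ)..t, c s) * (g t * Real.exp (-∫ s in (0 : ℝ)..t, c s)) = g t := by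
      rw [mul_left_comm, ← Real.exp_add]; simp
    rw [this]; ring

/-! ### Upper triangular linear systems and their exponential stability. -/

/-- `η̇ = C(t) η` on `[0, ∞)` in integrated form, coordinate by coordinate. -/
def SolvesLinear {d : ℕ} (C : ℝ → Matrix (Fin d) (Fin d) ℝ) (η : ℝ → Fin d → ℝ) : Prop :=
  ∀ i, HasPrimitive (fun t => η t i) fun t => (C t *ᵥ η t) i

/-- `C(t)` is upper triangular for all `t ≥ 0`. -/
def UpperTriangular {d : ℕ} (C : ℝ → Matrix (Fin d) (Fin d) ℝ) : Prop :=
  ∀ t, 0 ≤ t → ∀ i l, l < i → C t i l = 0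

theorem UpperTriangular.mulVec_apply {d : ℕ} {C : ℝ → Matrix (Fin d) (Fin d) ℝ}
    (hC : UpperTriangular C) {t : ℝ} (ht : 0 ≤ t) (w : Fin d → ℝ) (i : Fin d) :
    (C t *ᵥ w) i = C t i i * w i + ∑ l ∈ Finset.Ioi i, C t i l * w l := by
  rw [mulVec, dotProduct, ← Finset.sum_erase_add _ _ (Finset.mem_univ i), add_comm]
  congr 1
  symm
  refine Finset.sum_subset (fun l hl => ?_) fun l hl hl' => ?_
  · simpa using (Finset.mem_Ioi.1 hl).ne'
  · have : l < i := lt_of_le_of_ne (not_lt.1 fun h => hl' (Finset.mem_Ioi.2 h))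
      (Finset.ne_of_mem_erase hl)
    rw [hC t ht i l this, zero_mul]

theorem SolvesLinear.row {d : ℕ} {C : ℝ → Matrix (Fin d) (Fin d) ℝ} {η : ℝ → Fin d → ℝ}
    (hη : SolvesLinear C η) (hC : UpperTriangular C) (i : Fin d) :
    HasPrimitive (fun t => η t i)
      fun t => C t i i * η t i + ∑ l ∈ Finset.Ioi i, C t i l * η t l :=
  (hη i).congr (fun _ _ => rfl) fun _ ht => hC.mulVec_apply ht _ i

/-- A triangular linear system can be solved from the last coordinate upwards. -/
theorem UpperTriangular.exists_solvesLinear {d : ℕ} {C : ℝ → Matrix (Fin d) (Fin d) ℝ}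
    (hC : UpperTriangular C) (hCint : ∀ i l, LocInt fun t => C t i l) (v : Fin d → ℝ) :
    ∃ η : ℝ → Fin d → ℝ, η 0 = v ∧ SolvesLinear C η := by
  -- Induction on the number `n` of trailing coordinates already solved: `d ≤ i + n` says that `i`
  -- is among the last `n`.
  suffices H : ∀ n : ℕ, ∃ η : ℝ → Fin d → ℝ, ∀ i : Fin d, d ≤ i + n → η 0 i = v i ∧
      HasPrimitive (fun t => η t i)
        fun t => C t i i * η t i + ∑ l ∈ Finset.Ioi i, C t i l * η t l by
    obtain ⟨η, h⟩ := H d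
    refine ⟨η, funext fun i => (h i (by omega)).1, fun i => ?_⟩
    exact (h i (by omega)).2.congr (fun _ _ => rfl) fun _ ht => (hC.mulVec_apply ht _ i).symm
  intro n
  induction n with
  | zero => exact ⟨0, fun i hi => by omega⟩
  | succ n ih =>
    obtain ⟨η, h⟩ := ih
    by_cases hn : n + 1 ≤ d
    swap
    · exact ⟨η, fun i hi => h i (by omega)⟩
    let i₀ : Fin d := ⟨d - (n + 1), by omega⟩
    have hg : LocInt fun t => ∑ l ∈ Finset.Ioi i₀, C t i₀ l * η t l := by
      refine LocInt.sum _ fun l hl => (hCint i₀ l).mul_continuousOn fun T hT => ?_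
      have : (i₀ : ℕ) < l := Fin.lt_def.1 (Finset.mem_Ioi.1 hl)
      refine (h l ?_).2.continuousOn hT
      simp only [i₀] at this
      omega
    obtain ⟨f, hf0, hf⟩ := exists_hasPrimitive_linear (hCint i₀ i₀) hg (v i₀)
    refine ⟨fun t => Function.update (η t) i₀ (f t), fun i hi => ?_⟩
    have hsum : ∀ i, i₀ ≤ i → ∀ t, ∑ l ∈ Finset.Ioi i, C t i l * Function.update (η t) i₀ (f t) l =
        ∑ l ∈ Finset.Ioi i, C t i l * η t l := fun i hi t =>
      Finset.sum_congr rfl fun l hl => by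
        rw [Function.update_of_ne (hi.trans_lt (Finset.mem_Ioi.1 hl)).ne']
    have hi₀ : i₀ ≤ i := by
      rw [Fin.le_def]; simp only [i₀]; omega
    simp only [hsum i hi₀]
    rcases eq_or_lt_of_le hi₀ with rfl | hlt
    · simp only [Function.update_self]
      exact ⟨hf0, hf⟩
    · simp only [Function.update_of_ne hlt.ne']
      refine h i ?_
      have : (i₀ : ℕ) < i := hlt
      simp only [i₀] at this
      omega

theorem HasPrimitive.eq_mul_exp {f c : ℝ → ℝ} (hc : LocInt c)
    (hf : HasPrimitive f fun t => c t * f t) {t : ℝ} (ht : 0 ≤ t) :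
    f t = f 0 * Real.exp (∫ s in (0 : ℝ)..t, c s) := by
  have h : HasPrimitive f fun t => c t * f t + 0 := by simpa using hf
  have h1 := (h.mul_exp_neg (g := fun _ => 0) hc t ht).2
  simp only [intervalIntegral.integral_same, neg_zero, Real.exp_zero, mul_one, zero_mul,
    intervalIntegral.integral_zero, add_zero] at h1
  rw [← h1, mul_assoc, ← Real.exp_add]
  simp

/-- Row `i` involves only coordinates from `i` on, so descending induction leaves a homogeneous
scalar equation with zero initial value. -/
theorem SolvesLinear.eq_zero {d : ℕ} {C : ℝ → Matrix (Fin d) (Fin d) ℝ} {η : ℝ → Fin d → ℝ}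
    (hη : SolvesLinear C η) (hC : UpperTriangular C) (hCint : ∀ i l, LocInt fun t => C t i l)
    {j : Fin d} (h0 : ∀ i, j < i → η 0 i = 0) : ∀ i, j < i → ∀ t, 0 ≤ t → η t i = 0 := by
  intro i
  induction i using WellFoundedGT.induction with
  | ind i ih =>
    intro hi t ht
    have h1 : HasPrimitive (fun t => η t i) fun t => C t i i * η t i := by
      refine (hη.row hC i).congr (fun _ _ => rfl) fun s hs => ?_
      rw [Finset.sum_eq_zero, add_zero]
      intro l hl
      have hl := Finset.mem_Ioi.1 hl
      rw [ih l hl (hi.trans hl) s hs, mul_zero]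
    rw [h1.eq_mul_exp (hCint i i) ht, h0 i hi, zero_mul]

/-- The last non-zero coordinate of a solution of a triangular system. -/
theorem SolvesLinear.eq_mul_exp {d : ℕ} {C : ℝ → Matrix (Fin d) (Fin d) ℝ} {η : ℝ → Fin d → ℝ}
    (hη : SolvesLinear C η) (hC : UpperTriangular C) (hCint : ∀ i l, LocInt fun t => C t i l)
    {j : Fin d} (h0 : ∀ i, j < i → η 0 i = 0) {t : ℝ} (ht : 0 ≤ t) :
    η t j = η 0 j * Real.exp (∫ s in (0 : ℝ)..t, C s j j) := by
  refine HasPrimitive.eq_mul_exp (f := fun t => η t j) (hCint j j) ?_ ht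
  refine (hη.row hC j).congr (fun _ _ => rfl) fun s hs => ?_
  rw [Finset.sum_eq_zero, add_zero]
  intro l hl
  rw [hη.eq_zero hC hCint h0 l (Finset.mem_Ioi.1 hl) s hs, mul_zero]

/-- Convergence of the averages gives the bound for large `t`; continuity on a compact interval
supplies `D` for the rest. -/
theorem LocInt.exists_integral_bound {c : ℝ → ℝ} (hc : LocInt c) {m : ℝ}
    (hm : Tendsto (timeAverage c) atTop (𝓝 m)) {ε : ℝ} (hε : 0 < ε) :
    ∃ D, ∀ t, 0 ≤ t → |(∫ s in (0 : ℝ)..t, c s) - m * t| ≤ ε * t + D := by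
  obtain ⟨T, hT⟩ := eventually_atTop.1 (Metric.tendsto_nhds.1 hm ε hε)
  have hcont : ContinuousOn (fun t => (∫ s in (0 : ℝ)..t, c s) - m * t) (uIcc 0 (max T 1)) := by
    have h1 : HasPrimitive (fun t => ∫ s in (0 : ℝ)..t, c s) c := by
      simpa using hc.hasPrimitive 0
    exact (h1.continuousOn (by positivity)).sub (by fun_prop)
  obtain ⟨D, hD⟩ := isCompact_uIcc.exists_bound_of_continuousOn hcont
  have hD0 : 0 ≤ D := (norm_nonneg _).trans (hD 0 (by simp))
  refine ⟨D, fun t ht => ?_⟩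
  by_cases h : t ≤ max T 1
  · have := hD t (by rw [uIcc_of_le (by positivity)]; exact ⟨ht, h⟩)
    rw [Real.norm_eq_abs] at this
    nlinarith [mul_nonneg hε.le ht]
  · push Not at h
    have ht1 : 0 < t := lt_trans one_pos ((le_max_right _ _).trans_lt h)
    have h2 := hT t ((le_max_left _ _).trans h.le)
    rw [Real.dist_eq, timeAverage] at h2
    have h3 : (∫ s in (0 : ℝ)..t, c s) - m * t = (1 / t * (∫ s in (0 : ℝ)..t, c s) - m) * t := by
      field_simp
    rw [h3, abs_mul, abs_of_pos ht1]
    nlinarith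

/-- Scalar equation with a negative mean coefficient and exponentially decaying forcing. -/
theorem exists_decay_of_scalar {c : ℝ → ℝ} (hc : LocInt c) {m a : ℝ} (hm : m < 0) (ha : 0 < a)
    (hlim : Tendsto (timeAverage c) atTop (𝓝 m)) :
    ∃ K, 0 ≤ K ∧ ∃ b, 0 < b ∧ ∀ (f g : ℝ → ℝ) (G : ℝ), 0 ≤ G →
      HasPrimitive f (fun t => c t * f t + g t) → (∀ t, 0 ≤ t → |g t| ≤ G * Real.exp (-a * t)) →
      ∀ t, 0 ≤ t → |f t| ≤ K * Real.exp (-b * t) * (|f 0| + G) := by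
  set α := min a (-m) / 2 with hα
  have hα0 : 0 < α := by
    have : 0 < min a (-m) := lt_min ha (by linarith)
    positivity
  have hαa : α ≤ a := by linarith [min_le_left a (-m), hα]
  have hαm : α ≤ -m := by linarith [min_le_right a (-m), hα]
  -- Three losses of `ε` occur, two from the bound on `∫ c` and one from absorbing a factor `t` into
  -- `exp (ε t)`; `-α + 3 ε = -ε` is the rate that survives.
  set ε := α / 4 with hε
  have hε0 : 0 < ε := by positivity
  obtain ⟨D, hD⟩ := hc.exists_integral_bound hlim hε0
  refine ⟨Real.exp D + Real.exp (2 * D) / ε, by positivity, ε, hε0, ?_⟩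
  intro f g G hG hf hg t ht
  have h1 := (hf.mul_exp_neg hc t ht).2
  simp only [intervalIntegral.integral_same, neg_zero, Real.exp_zero, mul_one] at h1
  have hbound : ‖∫ s in (0 : ℝ)..t, g s * Real.exp (-∫ r in (0 : ℝ)..s, c r)‖ ≤
      (G * Real.exp ((-m + ε - α) * t + D)) * |t - 0| := by
    refine intervalIntegral.norm_integral_le_of_norm_le_const fun s hs => ?_
    rw [uIoc_of_le ht] at hs
    have hs0 := hs.1.le
    rw [norm_mul, Real.norm_eq_abs, Real.norm_of_nonneg (Real.exp_pos _).le]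
    have h2 := (abs_le.1 (hD s hs0)).1
    calc |g s| * Real.exp (-∫ r in (0 : ℝ)..s, c r)
        ≤ (G * Real.exp (-a * s)) * Real.exp (-m * s + (ε * s + D)) := by
          gcongr
          · exact hg s hs0
          · linarith
      _ = G * Real.exp (-a * s + (-m * s + (ε * s + D))) := by rw [mul_assoc, ← Real.exp_add]
      _ ≤ G * Real.exp ((-m + ε - α) * t + D) := by
          -- As `α ≤ -m`, the exponent has a non-negative slope, so the integrand's bound is largest
          -- at `s = t`.
          have : (-m + ε - α) * s ≤ (-m + ε - α) * t :=
            mul_le_mul_of_nonneg_left hs.2 (by linarith)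
          exact mul_le_mul_of_nonneg_left (Real.exp_le_exp.2 (by nlinarith)) hG
  rw [sub_zero, abs_of_nonneg ht, Real.norm_eq_abs] at hbound
  have hft : f t = (f 0 + ∫ s in (0 : ℝ)..t, g s * Real.exp (-∫ r in (0 : ℝ)..s, c r)) *
      Real.exp (∫ s in (0 : ℝ)..t, c s) := by
    rw [← h1, mul_assoc, ← Real.exp_add]; simp
  have hE : Real.exp (∫ s in (0 : ℝ)..t, c s) ≤ Real.exp (m * t + (ε * t + D)) := by
    have h2 := (abs_le.1 (hD t ht)).2
    gcongr; linarith
  have htε : t ≤ Real.exp (ε * t) / ε := by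
    rw [le_div_iff₀ hε0]
    linarith [Real.add_one_le_exp (ε * t)]
  calc |f t| ≤ (|f 0| + G * Real.exp ((-m + ε - α) * t + D) * t) *
        Real.exp (m * t + (ε * t + D)) := by
        rw [hft, abs_mul, abs_of_pos (Real.exp_pos _)]
        gcongr
        exact (abs_add_le _ _).trans (by gcongr)
    _ ≤ (|f 0| + G * Real.exp ((-m + ε - α) * t + D) * (Real.exp (ε * t) / ε)) *
        Real.exp (m * t + (ε * t + D)) := by gcongr
    _ = |f 0| * Real.exp (m * t + (ε * t + D)) + G / ε *
        (Real.exp ((-m + ε - α) * t + D) * Real.exp (ε * t) *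
          Real.exp (m * t + (ε * t + D))) := by ring
    _ = |f 0| * Real.exp (m * t + (ε * t + D)) + G / ε * Real.exp (-ε * t + 2 * D) := by
        rw [← Real.exp_add, ← Real.exp_add]
        congr 3
        rw [hε]; ring
    _ ≤ |f 0| * Real.exp (-ε * t + D) + G / ε * Real.exp (-ε * t + 2 * D) := by
        have : m * t + (ε * t + D) ≤ -ε * t + D := by nlinarith
        gcongr |f 0| * ?_ + _
        exact Real.exp_le_exp.2 this
    _ = Real.exp (-ε * t) * (|f 0| * Real.exp D + G * (Real.exp (2 * D) / ε)) := by
        rw [Real.exp_add, Real.exp_add]; ring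
    _ ≤ Real.exp (-ε * t) * ((Real.exp D + Real.exp (2 * D) / ε) * (|f 0| + G)) := by
        gcongr
        have h3 : 0 ≤ |f 0| * (Real.exp (2 * D) / ε) := by positivity
        have h4 : 0 ≤ G * Real.exp D := by positivity
        nlinarith
    _ = _ := by ring

/-- A bounded triangular system whose diagonal entries have negative means is exponentially
stable. -/
theorem UpperTriangular.exists_decay {d : ℕ} {C : ℝ → Matrix (Fin d) (Fin d) ℝ}
    (hC : UpperTriangular C) (hCint : ∀ i l, LocInt fun t => C t i l) {M : ℝ}
    (hM : ∀ t, 0 ≤ t → ∀ i l, |C t i l| ≤ M)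
    (hdiag : ∀ i, ∃ m < 0, Tendsto (timeAverage fun t => C t i i) atTop (𝓝 m)) :
    ∃ K, 0 ≤ K ∧ ∃ a, 0 < a ∧ ∀ (η : ℝ → Fin d → ℝ) (S : ℝ), SolvesLinear C η →
      (∀ i, |η 0 i| ≤ S) → 0 ≤ S →
      ∀ t, 0 ≤ t → ∀ i, |η t i| ≤ K * Real.exp (-a * t) * S := by
  suffices H : ∀ n : ℕ, ∃ K, 0 ≤ K ∧ ∃ a, 0 < a ∧ ∀ (η : ℝ → Fin d → ℝ) (S : ℝ),
      SolvesLinear C η → (∀ i, |η 0 i| ≤ S) → 0 ≤ S →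
      ∀ t, 0 ≤ t → ∀ i : Fin d, d ≤ i + n → |η t i| ≤ K * Real.exp (-a * t) * S by
    obtain ⟨K, hK, a, ha, h⟩ := H d
    exact ⟨K, hK, a, ha, fun η S h1 h2 hS t ht i => h η S h1 h2 hS t ht i (by omega)⟩
  intro n
  induction n with
  | zero => exact ⟨0, le_rfl, 1, one_pos, fun _ _ _ _ _ _ _ i hi => by omega⟩
  | succ n ih =>
    obtain ⟨K, hK, a, ha, h⟩ := ih
    by_cases hn : n + 1 ≤ d
    swap
    · exact ⟨K, hK, a, ha, fun η S h1 h2 hS t ht i hi => h η S h1 h2 hS t ht i (by omega)⟩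
    let i₀ : Fin d := ⟨d - (n + 1), by omega⟩
    obtain ⟨m, hm, hlim⟩ := hdiag i₀
    obtain ⟨K', hK', b, hb, h'⟩ := exists_decay_of_scalar (hCint i₀ i₀) hm ha hlim
    have hM0 : 0 ≤ M := (abs_nonneg _).trans (hM 0 le_rfl i₀ i₀)
    have hlt : ∀ l, l ∈ Finset.Ioi i₀ → d ≤ l + n := by
      intro l hl
      have : (i₀ : ℕ) < l := Fin.lt_def.1 (Finset.mem_Ioi.1 hl)
      simp only [i₀] at this
      omega
    -- Row `i₀` is a scalar equation forced by the later coordinates, and this forcing is at most `d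
    -- M K S e^{-a t}`.
    refine ⟨K + K' * (1 + d * (M * K)), by positivity, min a b, lt_min ha hb, ?_⟩
    intro η S hη h0 hS t ht i hi
    by_cases hin : d ≤ i + n
    · refine (h η S hη h0 hS t ht i hin).trans ?_
      have e1 : Real.exp (-a * t) ≤ Real.exp (-min a b * t) := by
        gcongr; exact min_le_left _ _
      have : K ≤ K + K' * (1 + d * (M * K)) := by
        have : 0 ≤ K' * (1 + d * (M * K)) := by positivity
        linarith
      gcongr
    · have hi0 : i = i₀ := by
        ext; simp only [i₀]; omega
      subst hi0
      have hg : ∀ s, 0 ≤ s → |∑ l ∈ Finset.Ioi i₀, C s i₀ l * η s l| ≤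
          (d * (M * K) * S) * Real.exp (-a * s) := by
        intro s hs
        calc |∑ l ∈ Finset.Ioi i₀, C s i₀ l * η s l|
            ≤ ∑ l ∈ Finset.Ioi i₀, |C s i₀ l * η s l| := Finset.abs_sum_le_sum_abs _ _
          _ ≤ ∑ l ∈ Finset.Ioi i₀, M * (K * Real.exp (-a * s) * S) := by
              refine Finset.sum_le_sum fun l hl => ?_
              rw [abs_mul]
              gcongr
              · exact hM s hs _ _
              · exact h η S hη h0 hS s hs l (hlt l hl)
          _ ≤ ∑ l : Fin d, M * (K * Real.exp (-a * s) * S) := by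
              refine Finset.sum_le_sum_of_subset_of_nonneg (Finset.subset_univ _) ?_
              intros; positivity
          _ = _ := by simp; ring
      have h2 := h' (fun t => η t i₀) _ (d * (M * K) * S) (by positivity) (hη.row hC i₀) hg t ht
      refine h2.trans ?_
      have e1 : Real.exp (-b * t) ≤ Real.exp (-min a b * t) := by
        gcongr; exact min_le_right _ _
      calc K' * Real.exp (-b * t) * (|η 0 i₀| + d * (M * K) * S)
          ≤ K' * Real.exp (-min a b * t) * (S + d * (M * K) * S) := by
            gcongr; exact h0 i₀
        _ = (K' * (1 + d * (M * K))) * Real.exp (-min a b * t) * S := by ring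
        _ ≤ _ := by gcongr; linarith

/-! ### Passage to the moving orthonormal frame. -/

theorem isSolution_iff {n : ℕ} {F : ℝ → (Fin n → ℝ) → (Fin n → ℝ)} {x₀ : Fin n → ℝ}
    {x : ℝ → Fin n → ℝ} : IsSolution F x₀ x ↔
      x 0 = x₀ ∧ ∀ i, HasPrimitive (fun t => x t i) fun t => F t (x t) i := by
  have key : ∀ {t : ℝ}, 0 ≤ t → ∀ {f : ℝ → Fin n → ℝ}, IntervalIntegrable f volume 0 t →
      ∀ i, (∫ s in (0 : ℝ)..t, f s) i = ∫ s in (0 : ℝ)..t, f s i := by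
    intro t ht f hf i
    rw [intervalIntegral.integral_of_le ht, intervalIntegral.integral_of_le ht]
    exact eval_integral (fun j => hf.1.eval j) i
  constructor
  · intro h
    have h0 : x 0 = x₀ := by simpa using (h 0 le_rfl).2
    refine ⟨h0, fun i t ht => ⟨⟨(h t ht).1.1.eval i, (h t ht).1.2.eval i⟩, ?_⟩⟩
    rw [← key ht (h t ht).1 i]
    subst h0
    exact congrFun (h t ht).2 i
  · rintro ⟨h0, h⟩ t ht
    have hi : IntervalIntegrable (fun s => F s (x s)) volume 0 t :=
      ⟨Integrable.of_eval fun i => (h i t ht).1.1, Integrable.of_eval fun i => (h i t ht).1.2⟩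
    refine ⟨hi, funext fun i => ?_⟩
    rw [Pi.add_apply, key ht hi i, ← h0]
    exact (h i t ht).2

theorem skewOfLower_transpose {k : ℕ} (M : Matrix (Fin k) (Fin k) ℝ) :
    (skewOfLower M)ᵀ = -skewOfLower M := by
  ext i j
  simp only [skewOfLower, transpose_apply, of_apply]
  rcases lt_trichotomy i j with h | h | h
  · simp [h, h.not_gt]
  · simp [h]
  · simp [h, h.not_gt]

/-- The coefficient matrix, in the moving orthonormal frame `QQ`, of `ξ̇ = M(t) ξ`. -/
def rotatedCoeff {d : ℕ} (A QQ M : ℝ → Matrix (Fin d) (Fin d) ℝ) (t : ℝ) :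
    Matrix (Fin d) (Fin d) ℝ :=
  (QQ t)ᵀ * M t * QQ t - skewOfLower ((QQ t)ᵀ * A t * QQ t)

section Frame

variable {d : ℕ} {A QQ M : ℝ → Matrix (Fin d) (Fin d) ℝ}

theorem IsContinuousQR.continuousOn {k : ℕ} {Q : ℝ → Matrix (Fin d) (Fin k) ℝ}
    (hQ : IsContinuousQR A Q) (i : Fin d) (j : Fin k) :
    ContinuousOn (fun t => Q t i j) (Ici 0) :=
  fun t ht => ((hQ t ht).2 i j).continuousWithinAt

theorem continuousOn_matrix_mul {l m n : ℕ} {X : ℝ → Matrix (Fin l) (Fin m) ℝ}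
    {Y : ℝ → Matrix (Fin m) (Fin n) ℝ} {s : Set ℝ}
    (hX : ∀ i j, ContinuousOn (fun t => X t i j) s)
    (hY : ∀ i j, ContinuousOn (fun t => Y t i j) s) (i : Fin l) (j : Fin n) :
    ContinuousOn (fun t => (X t * Y t) i j) s := by
  simp only [mul_apply]
  exact continuousOn_finsetSum _ fun m _ => (hX i m).mul (hY m j)

theorem IsContinuousQR.mul_transpose (hQQ : IsContinuousQR A QQ) {t : ℝ} (ht : 0 ≤ t) :
    QQ t * (QQ t)ᵀ = 1 :=
  mul_eq_one_comm.1 (hQQ t ht).1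

theorem IsContinuousQR.continuousOn_skew (hQQ : IsContinuousQR A QQ)
    (hA : ∀ i j, ContinuousOn (fun t => A t i j) (Ici 0)) (i j : Fin d) :
    ContinuousOn (fun t => skewOfLower ((QQ t)ᵀ * A t * QQ t) i j) (Ici 0) := by
  have h : ∀ i j, ContinuousOn (fun t => ((QQ t)ᵀ * A t * QQ t) i j) (Ici 0) :=
    continuousOn_matrix_mul
      (continuousOn_matrix_mul (fun i j => hQQ.continuousOn j i) hA) hQQ.continuousOn
  simp only [skewOfLower, of_apply]
  split_ifs
  · exact h i j
  · exact (h j i).neg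
  · exact continuousOn_const

theorem IsContinuousQR.hasPrimitive (hQQ : IsContinuousQR A QQ)
    (hA : ∀ i j, ContinuousOn (fun t => A t i j) (Ici 0)) (i j : Fin d) :
    HasPrimitive (fun t => QQ t i j)
      fun t => (QQ t * skewOfLower ((QQ t)ᵀ * A t * QQ t)) i j := by
  refine HasPrimitive.of_hasDerivWithinAt (fun t ht => ?_)
    (continuousOn_matrix_mul hQQ.continuousOn (hQQ.continuousOn_skew hA) i j)
  have := (hQQ t ht).2 i j
  rwa [qrField, hQQ.mul_transpose ht, sub_self, Matrix.zero_mul, Matrix.zero_mul, zero_add] at this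

/-- Product rule with `QQ' = QQ S` and `Sᵀ = -S`, after inserting `QQ QQᵀ = 1`. -/
theorem SolvesLinear.transpose_mulVec {ξ : ℝ → Fin d → ℝ} (hξ : SolvesLinear M ξ)
    (hQQ : IsContinuousQR A QQ) (hA : ∀ i j, ContinuousOn (fun t => A t i j) (Ici 0)) :
    SolvesLinear (rotatedCoeff A QQ M) fun t => (QQ t)ᵀ *ᵥ ξ t := by
  intro i
  refine (HasPrimitive.sum Finset.univ fun j _ =>
    (hQQ.hasPrimitive hA j i).mul (hξ j)).congr (fun _ _ => rfl) fun t ht => ?_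
  have h1 : rotatedCoeff A QQ M t *ᵥ ((QQ t)ᵀ *ᵥ ξ t) =
      (QQ t * skewOfLower ((QQ t)ᵀ * A t * QQ t))ᵀ *ᵥ ξ t + (QQ t)ᵀ *ᵥ (M t *ᵥ ξ t) := by
    rw [transpose_mul, skewOfLower_transpose, mulVec_mulVec, mulVec_mulVec, ← add_mulVec,
      rotatedCoeff, Matrix.sub_mul, Matrix.mul_assoc _ (QQ t), hQQ.mul_transpose ht,
      Matrix.mul_one, Matrix.neg_mul, neg_add_eq_sub]
  rw [h1, Finset.sum_add_distrib]
  rfl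

theorem SolvesLinear.mulVec {η : ℝ → Fin d → ℝ} (hη : SolvesLinear (rotatedCoeff A QQ M) η)
    (hQQ : IsContinuousQR A QQ) (hA : ∀ i j, ContinuousOn (fun t => A t i j) (Ici 0)) :
    SolvesLinear M fun t => QQ t *ᵥ η t := by
  intro i
  refine (HasPrimitive.sum Finset.univ fun j _ =>
    (hQQ.hasPrimitive hA i j).mul (hη j)).congr (fun _ _ => rfl) fun t ht => ?_
  have h1 : M t *ᵥ (QQ t *ᵥ η t) = (QQ t * skewOfLower ((QQ t)ᵀ * A t * QQ t)) *ᵥ η t +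
      QQ t *ᵥ (rotatedCoeff A QQ M t *ᵥ η t) := by
    rw [mulVec_mulVec, mulVec_mulVec, ← add_mulVec, rotatedCoeff, Matrix.mul_sub,
      add_sub_cancel, Matrix.mul_assoc _ (M t), ← Matrix.mul_assoc, hQQ.mul_transpose ht,
      Matrix.one_mul]
  rw [h1, Finset.sum_add_distrib]
  rfl

theorem enorm2_sq {n : ℕ} (v : Fin n → ℝ) : enorm2 v ^ 2 = v ⬝ᵥ v := by
  rw [enorm2, EuclideanSpace.norm_sq_eq]
  simp [dotProduct, sq]

theorem enorm2_nonneg {n : ℕ} (v : Fin n → ℝ) : 0 ≤ enorm2 v := norm_nonneg _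

theorem abs_le_enorm2 {n : ℕ} (v : Fin n → ℝ) (i : Fin n) : |v i| ≤ enorm2 v :=
  PiLp.norm_apply_le (WithLp.toLp 2 v) i

theorem enorm2_le_sum {n : ℕ} (v : Fin n → ℝ) : enorm2 v ≤ ∑ i, |v i| := by
  refine le_of_sq_le_sq ?_ (Finset.sum_nonneg fun _ _ => abs_nonneg _)
  rw [enorm2_sq, dotProduct]
  calc ∑ i, v i * v i = ∑ i, |v i| ^ 2 := by simp [sq]
    _ ≤ _ := Finset.sum_sq_le_sq_sum_of_nonneg fun _ _ => abs_nonneg _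

theorem enorm2_mulVec {m n : ℕ} {U : Matrix (Fin m) (Fin n) ℝ} (hU : Uᵀ * U = 1)
    (v : Fin n → ℝ) : enorm2 (U *ᵥ v) = enorm2 v := by
  have h : enorm2 (U *ᵥ v) ^ 2 = enorm2 v ^ 2 := by
    rw [enorm2_sq, enorm2_sq, dotProduct_mulVec, ← mulVec_transpose, mulVec_mulVec, hU, one_mulVec]
  exact (sq_eq_sq₀ (enorm2_nonneg _) (enorm2_nonneg _)).1 h

end Frame

/-! ### Bounded measurable coefficients and the Gram–Schmidt factors. -/

/-- `f` is measurable and bounded on `[0, ∞)`. -/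
def BddMeas (f : ℝ → ℝ) : Prop :=
  AEMeasurable f (volume.restrict (Ici 0)) ∧ ∃ K, ∀ t, 0 ≤ t → |f t| ≤ K

theorem BddMeas.mul {f g : ℝ → ℝ} (hf : BddMeas f) (hg : BddMeas g) :
    BddMeas fun t => f t * g t := by
  obtain ⟨hf, K, hK⟩ := hf
  obtain ⟨hg, K', hK'⟩ := hg
  refine ⟨hf.mul hg, K * K', fun t ht => ?_⟩
  rw [abs_mul]
  exact mul_le_mul (hK t ht) (hK' t ht) (abs_nonneg _) ((abs_nonneg _).trans (hK t ht))

theorem BddMeas.sub {f g : ℝ → ℝ} (hf : BddMeas f) (hg : BddMeas g) :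
    BddMeas fun t => f t - g t := by
  obtain ⟨hf, K, hK⟩ := hf
  obtain ⟨hg, K', hK'⟩ := hg
  exact ⟨hf.sub hg, K + K', fun t ht => (abs_sub _ _).trans (add_le_add (hK t ht) (hK' t ht))⟩

theorem BddMeas.neg {f : ℝ → ℝ} (hf : BddMeas f) : BddMeas fun t => -f t :=
  ⟨hf.1.neg, hf.2.imp fun _ h t ht => (abs_neg (f t)).le.trans (h t ht)⟩

theorem bddMeas_const (c : ℝ) : BddMeas fun _ => c := ⟨aemeasurable_const, |c|, fun _ _ => le_rfl⟩

theorem BddMeas.sum {ι : Type*} (s : Finset ι) {f : ι → ℝ → ℝ} (h : ∀ i ∈ s, BddMeas (f i)) :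
    BddMeas fun t => ∑ i ∈ s, f i t := by
  classical
  induction s using Finset.induction_on with
  | empty => simpa using bddMeas_const 0
  | insert a s ha ih =>
    simp only [Finset.sum_insert ha]
    have h1 := (h a (by simp)).sub (ih fun i hi => h i (by simp [hi])).neg
    simpa using h1

theorem BddMeas.matrix_mul {l m n : ℕ} {X : ℝ → Matrix (Fin l) (Fin m) ℝ}
    {Y : ℝ → Matrix (Fin m) (Fin n) ℝ} (hX : ∀ i j, BddMeas fun t => X t i j)
    (hY : ∀ i j, BddMeas fun t => Y t i j) (i : Fin l) (j : Fin n) :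
    BddMeas fun t => (X t * Y t) i j := by
  simp only [mul_apply]
  exact BddMeas.sum _ fun m _ => (hX i m).mul (hY m j)

theorem BddMeas.locInt {f : ℝ → ℝ} (hf : BddMeas f) : LocInt f := by
  obtain ⟨hf, K, hK⟩ := hf
  intro t ht
  have hsub : Ioc 0 t ⊆ Ici (0 : ℝ) := fun x hx => hx.1.le
  rw [intervalIntegrable_iff_integrableOn_Ioc_of_le ht]
  refine Integrable.of_bound
    (hf.mono_measure (Measure.restrict_mono hsub le_rfl)).aestronglyMeasurable K ?_
  rw [ae_restrict_iff' measurableSet_Ioc]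
  exact ae_of_all _ fun x hx => hK x hx.1.le

theorem enorm2_single {n : ℕ} (j : Fin n) : enorm2 (Pi.single j 1 : Fin n → ℝ) = 1 := by
  have h := enorm2_sq (Pi.single j 1 : Fin n → ℝ)
  simp only [single_dotProduct, Pi.single_eq_same, mul_one] at h
  nlinarith [enorm2_nonneg (Pi.single j 1 : Fin n → ℝ)]

theorem BoundedInTime.exists_abs_le {m n : ℕ} {M : ℝ → Matrix (Fin m) (Fin n) ℝ}
    (hM : BoundedInTime M) (i : Fin m) (j : Fin n) : ∃ K, ∀ t, 0 ≤ t → |M t i j| ≤ K := by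
  obtain ⟨K, hK⟩ := hM
  refine ⟨K, fun t ht => ?_⟩
  have h := (abs_le_enorm2 _ i).trans (hK t ht _ (enorm2_single j))
  simpa using h

theorem abs_le_one_of_transpose_mul {m n : ℕ} {U : Matrix (Fin m) (Fin n) ℝ} (hU : Uᵀ * U = 1)
    (i : Fin m) (j : Fin n) : |U i j| ≤ 1 := by
  have h := abs_le_enorm2 (U *ᵥ Pi.single j 1) i
  rw [enorm2_mulVec hU, enorm2_single] at h
  simpa using h

theorem IsContinuousQR.bddMeas {d k : ℕ} {A : ℝ → Matrix (Fin d) (Fin d) ℝ}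
    {Q : ℝ → Matrix (Fin d) (Fin k) ℝ} (hQ : IsContinuousQR A Q) (i : Fin d) (j : Fin k) :
    BddMeas fun t => Q t i j :=
  ⟨(hQ.continuousOn i j).aemeasurable measurableSet_Ici, 1,
    fun t ht => abs_le_one_of_transpose_mul (hQ t ht).1 i j⟩

/-- Rank drops are harmless: projection onto a line is an explicit quotient by a squared norm,
measurable with the convention that division by zero gives zero. -/
theorem aemeasurable_gramSchmidt {d k : ℕ} {μ : Measure ℝ}
    {f : ℝ → Fin k → EuclideanSpace ℝ (Fin d)} (hf : ∀ l, AEMeasurable (fun t => f t l) μ)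
    (j : Fin k) : AEMeasurable (fun t => InnerProductSpace.gramSchmidt ℝ (f t) j) μ := by
  induction j using WellFoundedLT.induction with
  | ind j ih =>
    simp only [InnerProductSpace.gramSchmidt_def ℝ _ j, Submodule.starProjection_singleton]
    refine (hf j).sub (Finset.aemeasurable_fun_sum _ fun i hi => ?_)
    have hi := ih i (Finset.mem_Iio.1 hi)
    exact ((hi.inner (hf j)).div ((hi.norm.pow_const 2))).smul hi

theorem aemeasurable_thinQ {d k : ℕ} {μ : Measure ℝ} {Y : ℝ → Matrix (Fin d) (Fin k) ℝ}
    (hY : ∀ i j, AEMeasurable (fun t => Y t i j) μ) (i : Fin d) (j : Fin k) :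
    AEMeasurable (fun t => thinQ (Y t) i j) μ := by
  have h1 : ∀ l, AEMeasurable
      (fun t => (WithLp.toLp 2 (fun m => Y t m l) : EuclideanSpace ℝ (Fin d))) μ := fun l =>
    (WithLp.measurable_toLp 2 _).comp_aemeasurable (aemeasurable_pi_iff.2 fun m => hY m l)
  have h2 := aemeasurable_gramSchmidt h1 j
  have h3 : AEMeasurable (fun t => InnerProductSpace.gramSchmidtNormed ℝ
      (fun l : Fin k => (WithLp.toLp 2 (fun m => Y t m l) : EuclideanSpace ℝ (Fin d))) j) μ :=
    h2.norm.inv.smul h2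
  exact ((measurable_pi_apply i).comp (WithLp.measurable_ofLp 2 _)).comp_aemeasurable h3

theorem abs_thinQ_le_one {d k : ℕ} (Y : Matrix (Fin d) (Fin k) ℝ) (i : Fin d) (j : Fin k) :
    |thinQ Y i j| ≤ 1 := by
  refine (PiLp.norm_apply_le (InnerProductSpace.gramSchmidtNormed ℝ
      (fun l : Fin k => (WithLp.toLp 2 (fun m => Y m l) : EuclideanSpace ℝ (Fin d))) j) i).trans ?_
  by_cases h : InnerProductSpace.gramSchmidtNormed ℝ
      (fun l : Fin k => (WithLp.toLp 2 (fun m => Y m l) : EuclideanSpace ℝ (Fin d))) j = 0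
  · simp [h]
  · exact (InnerProductSpace.gramSchmidtNormed_unit_length' h).le

theorem thinR_apply {d k : ℕ} (Y : Matrix (Fin d) (Fin k) ℝ) (i j : Fin k) :
    thinR Y i j = inner ℝ
      (InnerProductSpace.gramSchmidtNormed ℝ
        (fun l : Fin k => (WithLp.toLp 2 (fun m => Y m l) : EuclideanSpace ℝ (Fin d))) i)
      (WithLp.toLp 2 (fun m => Y m j) : EuclideanSpace ℝ (Fin d)) := by
  rw [PiLp.inner_apply, thinR, mul_apply]
  refine Finset.sum_congr rfl fun m _ => ?_
  simp [thinQ, mul_comm]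

/-- The `i`th Gram–Schmidt vector is orthogonal to all earlier columns. -/
theorem thinR_eq_zero {d k : ℕ} (Y : Matrix (Fin d) (Fin k) ℝ) {i j : Fin k} (h : j < i) :
    thinR Y i j = 0 := by
  rw [thinR_apply, InnerProductSpace.gramSchmidtNormed, inner_smul_left,
    InnerProductSpace.gramSchmidt_inv_triangular ℝ _ h, mul_zero]

/-- A column is its own Gram–Schmidt vector plus a combination of earlier ones, which are orthogonal
to it; only a squared norm remains. -/
theorem thinR_diag_nonneg {d k : ℕ} (Y : Matrix (Fin d) (Fin k) ℝ) (j : Fin k) :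
    0 ≤ thinR Y j j := by
  rw [thinR_apply, InnerProductSpace.gramSchmidtNormed, inner_smul_left]
  set f := fun l : Fin k => (WithLp.toLp 2 (fun m => Y m l) : EuclideanSpace ℝ (Fin d)) with hf
  refine mul_nonneg (by simp) ?_
  change 0 ≤ inner ℝ (InnerProductSpace.gramSchmidt ℝ f j) (f j)
  rw [InnerProductSpace.gramSchmidt_def'' ℝ f j, inner_add_right, inner_sum]
  rw [Finset.sum_eq_zero, add_zero]
  · exact real_inner_self_nonneg
  · intro i hi
    rw [inner_smul_right, InnerProductSpace.gramSchmidt_orthogonal ℝ f (Finset.mem_Iio.1 hi).ne',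
      mul_zero]

theorem coeffB_eq_zero {d k : ℕ} (A : ℝ → Matrix (Fin d) (Fin d) ℝ)
    (Q : ℝ → Matrix (Fin d) (Fin k) ℝ) (t : ℝ) {i l : Fin k} (h : l < i) :
    coeffB A Q t i l = 0 := by
  simp [coeffB, skewOfLower, h]

theorem coeffB_diag {d k : ℕ} (A : ℝ → Matrix (Fin d) (Fin d) ℝ)
    (Q : ℝ → Matrix (Fin d) (Fin k) ℝ) (t : ℝ) (i : Fin k) :
    coeffB A Q t i i = ((Q t)ᵀ * A t * Q t) i i := by
  simp [coeffB, skewOfLower]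

/-! ### The error equation in the frame. -/

/-- The coefficient matrix `A - L H` of the error equation. -/
def errorCoeff {d k s : ℕ} (A : ℝ → Matrix (Fin d) (Fin d) ℝ) (H : ℝ → Matrix (Fin s) (Fin d) ℝ)
    (Q : ℝ → Matrix (Fin d) (Fin k) ℝ) (p t : ℝ) : Matrix (Fin d) (Fin d) ℝ :=
  A t - gain H Q p t * H t

section Observer

variable {d k s : ℕ} {hkd : k ≤ d} {A QQ : ℝ → Matrix (Fin d) (Fin d) ℝ}
  {H : ℝ → Matrix (Fin s) (Fin d) ℝ} {Q : ℝ → Matrix (Fin d) (Fin k) ℝ}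

theorem coeffB_lead (hQlead : ∀ t, 0 ≤ t → ∀ i j, Q t i j = QQ t i (Fin.castLE hkd j)) {t : ℝ}
    (ht : 0 ≤ t) (j : Fin k) :
    coeffB A Q t j j = coeffB A QQ t (Fin.castLE hkd j) (Fin.castLE hkd j) := by
  simp only [coeffB_diag, mul_apply, transpose_apply, hQlead t ht]

theorem transpose_mul_lead (hQQ : IsContinuousQR A QQ)
    (hQlead : ∀ t, 0 ≤ t → ∀ i j, Q t i j = QQ t i (Fin.castLE hkd j)) {t : ℝ} (ht : 0 ≤ t)
    (i : Fin d) (m : Fin k) :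
    ((QQ t)ᵀ * Q t) i m = (1 : Matrix (Fin d) (Fin d) ℝ) i (Fin.castLE hkd m) := by
  rw [← (hQQ t ht).1, mul_apply, mul_apply]
  simp only [hQlead t ht]

theorem rotatedCoeff_errorCoeff (hQQ : IsContinuousQR A QQ)
    (hQlead : ∀ t, 0 ≤ t → ∀ i j, Q t i j = QQ t i (Fin.castLE hkd j)) (p : ℝ) {t : ℝ} (ht : 0 ≤ t)
    (i l : Fin d) :
    rotatedCoeff A QQ (errorCoeff A H Q p) t i l = coeffB A QQ t i l -
      p * ∑ m, (1 : Matrix (Fin d) (Fin d) ℝ) i (Fin.castLE hkd m) *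
        ((thinQ (observedBasis H Q t))ᵀ * ((H t)ᵀ * H t * QQ t)) m l := by
  have h1 : rotatedCoeff A QQ (errorCoeff A H Q p) t = coeffB A QQ t -
      p • (((QQ t)ᵀ * Q t) * ((thinQ (observedBasis H Q t))ᵀ * ((H t)ᵀ * H t * QQ t))) := by
    simp only [rotatedCoeff, errorCoeff, coeffB, gain, Matrix.mul_sub, Matrix.sub_mul,
      Matrix.smul_mul, Matrix.mul_smul, Matrix.mul_assoc]
    abel
  rw [h1, Matrix.sub_apply, Matrix.smul_apply, mul_apply, smul_eq_mul]
  simp only [transpose_mul_lead hQQ hQlead ht]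

theorem rotatedCoeff_lead (hQQ : IsContinuousQR A QQ)
    (hQlead : ∀ t, 0 ≤ t → ∀ i j, Q t i j = QQ t i (Fin.castLE hkd j)) (p : ℝ) {t : ℝ} (ht : 0 ≤ t)
    (i l : Fin k) :
    rotatedCoeff A QQ (errorCoeff A H Q p) t (Fin.castLE hkd i) (Fin.castLE hkd l) =
      coeffB A QQ t (Fin.castLE hkd i) (Fin.castLE hkd l) -
        p * thinR (observedBasis H Q t) i l := by
  rw [rotatedCoeff_errorCoeff hQQ hQlead p ht, Finset.sum_eq_single i]
  · have e : ∀ j, ((H t)ᵀ * H t * QQ t) j (Fin.castLE hkd l) = observedBasis H Q t j l := by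
      intro j
      rw [observedBasis, Matrix.mul_apply, Matrix.mul_apply]
      simp only [hQlead t ht]
    rw [one_apply_eq, one_mul, thinR, Matrix.mul_apply, Matrix.mul_apply]
    simp only [e]
  · intro m _ hm
    rw [one_apply_ne, zero_mul]
    exact fun h => hm (Fin.castLE_injective hkd h).symm
  · simp

/-- The gain takes values in the span of `Q`, which is orthogonal to the trailing frame vectors. -/
theorem rotatedCoeff_tail (hQQ : IsContinuousQR A QQ)
    (hQlead : ∀ t, 0 ≤ t → ∀ i j, Q t i j = QQ t i (Fin.castLE hkd j)) (p : ℝ) {t : ℝ} (ht : 0 ≤ t)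
    {i : Fin d} (hi : k ≤ i) (l : Fin d) :
    rotatedCoeff A QQ (errorCoeff A H Q p) t i l = coeffB A QQ t i l := by
  rw [rotatedCoeff_errorCoeff hQQ hQlead p ht, Finset.sum_eq_zero, mul_zero, sub_zero]
  intro m _
  rw [one_apply_ne, zero_mul]
  rintro rfl
  simp at hi
  omega

theorem upperTriangular_errorCoeff (hQQ : IsContinuousQR A QQ)
    (hQlead : ∀ t, 0 ≤ t → ∀ i j, Q t i j = QQ t i (Fin.castLE hkd j)) (p : ℝ) :
    UpperTriangular (rotatedCoeff A QQ (errorCoeff A H Q p)) := by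
  intro t ht i l hl
  by_cases hi : (i : ℕ) < k
  · have e1 : i = Fin.castLE hkd ⟨i, hi⟩ := rfl
    have e2 : l = Fin.castLE hkd ⟨l, (Fin.lt_def.1 hl).trans hi⟩ := rfl
    rw [e1, e2, rotatedCoeff_lead hQQ hQlead p ht, ← e1, ← e2, coeffB_eq_zero A QQ t hl,
      thinR_eq_zero _ (Fin.mk_lt_mk.2 hl), mul_zero, sub_zero]
  · rw [rotatedCoeff_tail hQQ hQlead p ht (not_lt.1 hi), coeffB_eq_zero A QQ t hl]

theorem bddMeas_thinQ (hQ : IsContinuousQR A Q) (hH : ∀ i j, BddMeas fun t => H t i j)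
    (i : Fin d) (j : Fin k) : BddMeas fun t => thinQ (observedBasis H Q t) i j :=
  ⟨aemeasurable_thinQ (fun i j => (BddMeas.matrix_mul (BddMeas.matrix_mul
    (X := fun t => (H t)ᵀ) (fun i j => hH j i) hH) hQ.bddMeas i j).1) i j, 1,
    fun _ _ => abs_thinQ_le_one _ i j⟩

theorem bddMeas_thinR (hQ : IsContinuousQR A Q) (hH : ∀ i j, BddMeas fun t => H t i j)
    (i j : Fin k) : BddMeas fun t => thinR (observedBasis H Q t) i j :=
  BddMeas.matrix_mul (X := fun t => (thinQ (observedBasis H Q t))ᵀ)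
    (fun i j => bddMeas_thinQ hQ hH j i) (fun i j => BddMeas.matrix_mul (BddMeas.matrix_mul
      (X := fun t => (H t)ᵀ) (fun i j => hH j i) hH) hQ.bddMeas i j) i j

theorem bddMeas_errorCoeff (hA : ∀ i j, BddMeas fun t => A t i j) (hQ : IsContinuousQR A Q)
    (hH : ∀ i j, BddMeas fun t => H t i j) (p : ℝ) (i j : Fin d) :
    BddMeas fun t => errorCoeff A H Q p t i j := by
  refine (hA i j).sub (BddMeas.matrix_mul (fun i j => ?_) hH i j)
  exact (bddMeas_const p).mul (BddMeas.matrix_mul (BddMeas.matrix_mul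
    (Y := fun t => (thinQ (observedBasis H Q t))ᵀ) hQ.bddMeas
      fun i j => bddMeas_thinQ hQ hH j i) (Y := fun t => (H t)ᵀ) (fun i j => hH j i) i j)

theorem bddMeas_rotatedCoeff {M : ℝ → Matrix (Fin d) (Fin d) ℝ}
    (hA : ∀ i j, BddMeas fun t => A t i j)
    (hM : ∀ i j, BddMeas fun t => M t i j) (hQQ : IsContinuousQR A QQ) (i j : Fin d) :
    BddMeas fun t => rotatedCoeff A QQ M t i j := by
  have h : ∀ {M : ℝ → Matrix (Fin d) (Fin d) ℝ}, (∀ i j, BddMeas fun t => M t i j) →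
      ∀ i j, BddMeas fun t => ((QQ t)ᵀ * M t * QQ t) i j := fun hM =>
    BddMeas.matrix_mul (BddMeas.matrix_mul (X := fun t => (QQ t)ᵀ)
      (fun i j => hQQ.bddMeas j i) hM) hQQ.bddMeas
  refine (h hM i j).sub ?_
  simp only [skewOfLower, of_apply]
  split_ifs
  · exact h hA i j
  · exact (h hA j i).neg
  · exact bddMeas_const 0

end Observer

/-! ### Growth rates of the flow and the trailing diagonal entries of `B`. -/

theorem enorm2_add_le {n : ℕ} (v w : Fin n → ℝ) : enorm2 (v + w) ≤ enorm2 v + enorm2 w :=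
  norm_add_le (WithLp.toLp 2 v) (WithLp.toLp 2 w)

theorem enorm2_smul {n : ℕ} (c : ℝ) (v : Fin n → ℝ) : enorm2 (c • v) = |c| * enorm2 v :=
  norm_smul c (WithLp.toLp 2 v)

theorem enorm2_zero {n : ℕ} : enorm2 (0 : Fin n → ℝ) = 0 := norm_zero (E := EuclideanSpace ℝ (Fin n))

theorem timeAverage_le_of_exp_le {c : ℝ → ℝ} {K b t : ℝ} (ht : 0 < t)
    (h : Real.exp (∫ s in (0 : ℝ)..t, c s) ≤ K * Real.exp (b * t)) :
    timeAverage c t ≤ Real.log K / t + b := by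
  have hK : 0 < K := by
    by_contra hK
    have := mul_nonpos_of_nonpos_of_nonneg (not_lt.1 hK) (Real.exp_pos (b * t)).le
    linarith [Real.exp_pos (∫ s in (0 : ℝ)..t, c s)]
  rw [← Real.exp_log hK, ← Real.exp_add, Real.exp_le_exp] at h
  rw [timeAverage]
  have : Real.log K / t + b = 1 / t * (Real.log K + b * t) := by field_simp
  rw [this]
  gcongr

theorem timeAverage_congr {f g : ℝ → ℝ} (h : ∀ t, 0 ≤ t → f t = g t) {t : ℝ} (ht : 0 ≤ t) :
    timeAverage f t = timeAverage g t := by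
  rw [timeAverage, timeAverage, integral_congr_of_nonneg h ht]

theorem timeAverage_sub_mul {f g : ℝ → ℝ} (hf : LocInt f) (hg : LocInt g) (p : ℝ) {t : ℝ}
    (ht : 0 ≤ t) :
    timeAverage (fun s => f s - p * g s) t = timeAverage f t - p * timeAverage g t := by
  simp only [timeAverage]
  rw [intervalIntegral.integral_sub (hf t ht) ((hg t ht).const_mul p),
    intervalIntegral.integral_const_mul]
  ring

theorem tendsto_const_div_add (c b : ℝ) :
    Tendsto (fun t : ℝ => c / t + b) atTop (𝓝 b) := by
  simpa using (tendsto_const_nhds (x := c)).div_atTop tendsto_id |>.add_const b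

section Flow

variable {d : ℕ} {A Φ QQ : ℝ → Matrix (Fin d) (Fin d) ℝ}

theorem IsFlow.solvesLinear (hΦ : IsFlow A Φ)
    (hA : ∀ i j, ContinuousOn (fun t => A t i j) (Ici 0)) (v : Fin d → ℝ) :
    SolvesLinear A fun t => Φ t *ᵥ v := by
  have hΦc : ∀ i j, ContinuousOn (fun t => Φ t i j) (Ici 0) := fun i j t ht =>
    (hΦ.2 t ht i j).continuousWithinAt
  intro i
  refine HasPrimitive.of_hasDerivWithinAt (fun t ht => ?_) ?_
  · have h := HasDerivWithinAt.fun_sum (u := Finset.univ) fun j _ =>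
      (hΦ.2 t ht i j).mul_const (v j)
    rw [mulVec_mulVec]
    exact h
  · simp only [mulVec_mulVec]
    simp only [mulVec, dotProduct]
    refine continuousOn_finsetSum _ fun j _ => ?_
    exact (continuousOn_matrix_mul hA hΦc i j).mul continuousOn_const

/-- The vectors whose orbit is eventually bounded by a multiple of `e^{c t}`. -/
def growthSubspace (Φ : ℝ → Matrix (Fin d) (Fin d) ℝ) (c : ℝ) : Submodule ℝ (Fin d → ℝ) where
  carrier := {v | ∃ K : ℝ, ∀ᶠ t in atTop, enorm2 (Φ t *ᵥ v) ≤ K * Real.exp (c * t)}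
  zero_mem' := ⟨0, Eventually.of_forall fun t => by simp [enorm2_zero]⟩
  add_mem' := by
    rintro v w ⟨K, hK⟩ ⟨K', hK'⟩
    refine ⟨K + K', ?_⟩
    filter_upwards [hK, hK'] with t h h'
    rw [mulVec_add, add_mul]
    exact (enorm2_add_le _ _).trans (add_le_add h h')
  smul_mem' := by
    rintro a v ⟨K, hK⟩
    refine ⟨|a| * K, ?_⟩
    filter_upwards [hK] with t h
    rw [mulVec_smul, enorm2_smul, mul_assoc]
    gcongr

theorem mem_growthSubspace_of_lyapunovExponent_lt {v : Fin d → ℝ} {c : ℝ}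
    (h : lyapunovExponent Φ v < c) : v ∈ growthSubspace Φ c := by
  by_cases hv : v = 0
  · rw [hv]; exact zero_mem _
  rw [lyapunovExponent, if_neg hv] at h
  refine ⟨1, ?_⟩
  filter_upwards [eventually_lt_of_limsup_lt h, eventually_gt_atTop 0] with t ht ht0
  rw [EReal.coe_lt_coe_iff] at ht
  rw [one_mul]
  -- At norm zero `Real.log` returns `0` and carries no information, but the bound is trivial.
  rcases (enorm2_nonneg (Φ t *ᵥ v)).eq_or_lt with h0 | h0
  · rw [← h0]; exact (Real.exp_pos _).le
  · rw [← Real.log_le_iff_le_exp h0]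
    rw [one_div, inv_mul_lt_iff₀ ht0] at ht
    linarith

theorem coeffB_upperTriangular : UpperTriangular (coeffB A QQ) :=
  fun t _ _ _ h => coeffB_eq_zero A QQ t h

theorem IsContinuousQR.locInt_coeffB (hQQ : IsContinuousQR A QQ)
    (hA : ∀ i j, BddMeas fun t => A t i j) (i j : Fin d) : LocInt fun t => coeffB A QQ t i j :=
  (bddMeas_rotatedCoeff hA hA hQQ i j).locInt

theorem IsContinuousQR.enorm2_transpose_mulVec (hQQ : IsContinuousQR A QQ) {t : ℝ} (ht : 0 ≤ t)
    (w : Fin d → ℝ) : enorm2 ((QQ t)ᵀ *ᵥ w) = enorm2 w :=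
  enorm2_mulVec (by rw [transpose_transpose, hQQ.mul_transpose ht]) w

/-- The last non-zero frame coordinate of `v` evolves by multiplication with an exponential, so it
never vanishes. This makes the logarithm in `lyapunovExponent` genuine. -/
theorem IsFlow.enorm2_pos (hΦ : IsFlow A Φ) (hAc : ∀ i j, ContinuousOn (fun t => A t i j) (Ici 0))
    (hA : ∀ i j, BddMeas fun t => A t i j) (hQQ : IsContinuousQR A QQ) {v : Fin d → ℝ}
    (hv : v ≠ 0) {t : ℝ} (ht : 0 ≤ t) : 0 < enorm2 (Φ t *ᵥ v) := by
  have hη : SolvesLinear (coeffB A QQ) _ := (hΦ.solvesLinear hAc v).transpose_mulVec hQQ hAc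
  set η := fun t => (QQ t)ᵀ *ᵥ (Φ t *ᵥ v) with hηdef
  have h0 : (Finset.univ.filter fun i => η 0 i ≠ 0).Nonempty := by
    by_contra hne
    rw [Finset.not_nonempty_iff_eq_empty] at hne
    have hz : η 0 = 0 := by
      ext i
      by_contra hi
      have : i ∈ Finset.univ.filter fun i => η 0 i ≠ 0 := by simpa using hi
      rw [hne] at this
      simp at this
    apply hv
    have h1 : QQ 0 *ᵥ η 0 = v := by
      rw [hηdef]
      simp only [mulVec_mulVec, hQQ.mul_transpose le_rfl, hΦ.1, one_mulVec]
    rw [← h1, hz, mulVec_zero]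
  obtain ⟨j, hj, hmax⟩ := Finset.exists_max_image _ id h0
  have hj0 : η 0 j ≠ 0 := by simpa using hj
  have hlater : ∀ i, j < i → η 0 i = 0 := by
    intro i hi
    by_contra hne
    exact absurd (hmax i (by simpa using hne)) (not_le.2 hi)
  have h1 := hη.eq_mul_exp coeffB_upperTriangular (hQQ.locInt_coeffB hA) hlater ht
  rw [← hQQ.enorm2_transpose_mulVec ht]
  refine lt_of_lt_of_le (abs_pos.2 ?_) (abs_le_enorm2 _ j)
  change η t j ≠ 0
  rw [h1]
  exact mul_ne_zero hj0 (Real.exp_pos _).ne'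

theorem IsFlow.lyapunovExponent_neg (hΦ : IsFlow A Φ)
    (hAc : ∀ i j, ContinuousOn (fun t => A t i j) (Ici 0))
    (hA : ∀ i j, BddMeas fun t => A t i j) (hQQ : IsContinuousQR A QQ) {v : Fin d → ℝ}
    {c : ℝ} (hc : c < 0) (h : v ∈ growthSubspace Φ c) : lyapunovExponent Φ v < 0 := by
  by_cases hv : v = 0
  · rw [lyapunovExponent, if_pos hv]; exact EReal.bot_lt_zero
  obtain ⟨K, hK⟩ := h
  rw [lyapunovExponent, if_neg hv]
  -- The gap between `c` and `c / 2` absorbs `log K / t`.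
  have hle : limsup (fun t : ℝ => ((1 / t * Real.log (enorm2 (Φ t *ᵥ v)) : ℝ) : EReal)) atTop ≤
      ((c / 2 : ℝ) : EReal) := by
    refine limsup_le_of_le (h := ?_)
    filter_upwards [hK, eventually_gt_atTop 0,
      (tendsto_const_div_add (Real.log K) c).eventually_lt_const (by linarith : c < c / 2)]
      with t h1 ht h2
    have hpos := hΦ.enorm2_pos hAc hA hQQ hv ht.le
    have hK0 : 0 < K := by
      by_contra hK0
      have := mul_nonpos_of_nonpos_of_nonneg (not_lt.1 hK0) (Real.exp_pos (c * t)).le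
      linarith
    rw [EReal.coe_le_coe_iff]
    have h3 := Real.log_le_log hpos h1
    rw [Real.log_mul hK0.ne' (Real.exp_pos _).ne', Real.log_exp] at h3
    have e : Real.log K / t + c = 1 / t * (Real.log K + c * t) := by field_simp
    rw [e] at h2
    refine le_trans ?_ h2.le
    gcongr
  refine hle.trans_lt ?_
  rw [← EReal.coe_zero, EReal.coe_lt_coe_iff]
  linarith

/-- If the leading columns of the frame are transversal to the stable subspace and as many as the
non-negative exponents, then the remaining diagonal entries of `B` have negative means. -/
theorem tail_average_neg {k : ℕ} {hkd : k ≤ d} (hΦ : IsFlow A Φ)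
    (hAc : ∀ i j, ContinuousOn (fun t => A t i j) (Ici 0))
    (hA : ∀ i j, BddMeas fun t => A t i j) (hQQ : IsContinuousQR A QQ)
    {lam : Fin d → ℝ} (hlam : IsLyapunovSpectrum Φ lam)
    (hk : k = (Finset.univ.filter fun i => 0 ≤ lam i).card)
    {Q : ℝ → Matrix (Fin d) (Fin k) ℝ} (hQ : IsContinuousQR A Q)
    (hQlead : ∀ t, 0 ≤ t → ∀ i j, Q t i j = QQ t i (Fin.castLE hkd j))
    (hQ0 : ∀ u : Fin k → ℝ, u ≠ 0 → 0 ≤ lyapunovExponent Φ (Q 0 *ᵥ u))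
    {i : Fin d} (hi : k ≤ i) {l : ℝ}
    (hl : Tendsto (timeAverage fun s => coeffB A QQ s i i) atTop (𝓝 l)) : l < 0 := by
  have hcard : (Finset.univ.filter fun i => lam i < 0).card = d - k := by
    have h := Finset.card_filter_add_card_filter_not (s := (Finset.univ : Finset (Fin d)))
      (fun i => 0 ≤ lam i)
    simp only [not_le, Finset.card_univ, Fintype.card_fin] at h
    omega
  -- `lam i₀` is the largest negative exponent, so `lam i ≤ lam i₀` selects exactly the negative
  -- ones and `W` is the stable subspace, of dimension `d - k`.
  obtain ⟨i₀, hi₀, hmax⟩ := Finset.exists_max_image (Finset.univ.filter fun i => lam i < 0) lam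
    (Finset.card_pos.1 (by have := i.2; omega))
  have hneg : lam i₀ < 0 := by simpa using hi₀
  set W := Submodule.span ℝ {v : Fin d → ℝ | lyapunovExponent Φ v ≤ (lam i₀ : EReal)} with hW
  have hWdim : Module.finrank ℝ W = d - k := by
    rw [hW, ← hlam.2 (lam i₀), ← hcard]
    congr 1
    ext i
    simp only [Finset.mem_filter, Finset.mem_univ, true_and]
    exact ⟨fun h => h.trans_lt hneg, fun h => hmax i (by simpa using h)⟩
  have hWle : W ≤ growthSubspace Φ (lam i₀ / 2) := by
    refine Submodule.span_le.2 fun v hv => mem_growthSubspace_of_lyapunovExponent_lt ?_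
    refine lt_of_le_of_lt hv ?_
    rw [EReal.coe_lt_coe_iff]
    linarith
  have hinj : Function.Injective (Q 0).mulVecLin := by
    refine Function.LeftInverse.injective (g := fun w => (Q 0)ᵀ *ᵥ w) fun w => ?_
    simp [mulVec_mulVec, (hQ 0 le_rfl).1]
  have hUdim := LinearMap.finrank_range_of_inj hinj
  have hdisj : Disjoint W (LinearMap.range (Q 0).mulVecLin) := by
    rw [Submodule.disjoint_def]
    rintro x hx ⟨u, rfl⟩
    by_cases hu : u = 0
    · simp [hu]
    · exact absurd (hQ0 u hu) (not_le.2
        (hΦ.lyapunovExponent_neg hAc hA hQQ (by linarith) (hWle hx)))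
  have htop := Submodule.eq_top_of_disjoint W _ (by rw [hWdim, hUdim]; simp; omega) hdisj
  -- Modulo the span of `Q 0`, the `i`th frame vector is a stable vector `w`; the correction affects
  -- only the first `k` frame coordinates.
  obtain ⟨w, hw, x, ⟨y, rfl⟩, hsum⟩ := Submodule.mem_sup.1
    (htop ▸ Submodule.mem_top : QQ 0 *ᵥ Pi.single i 1 ∈ W ⊔ LinearMap.range (Q 0).mulVecLin)
  have hw' : w = QQ 0 *ᵥ Pi.single i 1 - Q 0 *ᵥ y := by
    rw [← hsum]; simp
  have hη : SolvesLinear (coeffB A QQ) _ := (hΦ.solvesLinear hAc w).transpose_mulVec hQQ hAc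
  have hη0 : ∀ m : Fin d, k ≤ m →
      ((QQ 0)ᵀ *ᵥ (Φ 0 *ᵥ w)) m = (Pi.single i 1 : Fin d → ℝ) m := by
    intro m hm
    rw [hΦ.1, one_mulVec, hw', mulVec_sub, mulVec_mulVec, mulVec_mulVec, (hQQ 0 le_rfl).1,
      one_mulVec, Pi.sub_apply, sub_eq_self, mulVec, dotProduct]
    refine Finset.sum_eq_zero fun n _ => ?_
    rw [transpose_mul_lead hQQ hQlead le_rfl, one_apply_ne, zero_mul]
    rintro rfl
    simp at hm
    omega
  obtain ⟨K, hK⟩ := hWle hw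
  have hev : ∀ᶠ t in atTop, timeAverage (fun s => coeffB A QQ s i i) t ≤
      Real.log K / t + lam i₀ / 2 := by
    filter_upwards [hK, eventually_gt_atTop 0] with t h1 ht
    refine timeAverage_le_of_exp_le ht ?_
    have h2 := hη.eq_mul_exp coeffB_upperTriangular (hQQ.locInt_coeffB hA) (j := i)
      (fun m hm => by
        have : (i : ℕ) < m := hm
        rw [hη0 m (by omega), Pi.single_eq_of_ne hm.ne']) ht.le
    rw [hη0 i hi, Pi.single_eq_same, one_mul] at h2
    rw [← h2]
    refine ((le_abs_self _).trans (abs_le_enorm2 _ i)).trans ?_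
    rw [hQQ.enorm2_transpose_mulVec ht.le]
    exact h1
  have := le_of_tendsto_of_tendsto hl (tendsto_const_div_add _ _) hev
  linarith

end Flow

/-! ### Decay of the error and detectability. -/

section Observer

variable {d k s : ℕ} {hkd : k ≤ d} {A QQ Φ : ℝ → Matrix (Fin d) (Fin d) ℝ}
  {H : ℝ → Matrix (Fin s) (Fin d) ℝ} {Q : ℝ → Matrix (Fin d) (Fin k) ℝ}

theorem timeAverage_rotatedCoeff_lead (hAm : ∀ i j, BddMeas fun t => A t i j)
    (hHm : ∀ i j, BddMeas fun t => H t i j) (hQQ : IsContinuousQR A QQ) (hQ : IsContinuousQR A Q)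
    (hQlead : ∀ t, 0 ≤ t → ∀ i j, Q t i j = QQ t i (Fin.castLE hkd j)) (p : ℝ) (j : Fin k) {t : ℝ}
    (ht : 0 ≤ t) :
    timeAverage (fun s => rotatedCoeff A QQ (errorCoeff A H Q p) s (Fin.castLE hkd j)
        (Fin.castLE hkd j)) t =
      timeAverage (fun s => coeffB A QQ s (Fin.castLE hkd j) (Fin.castLE hkd j)) t -
        p * observability H Q j t := by
  rw [observability, ← timeAverage_sub_mul (hQQ.locInt_coeffB hAm _ _)
    (bddMeas_thinR hQ hHm j j).locInt p ht]
  exact timeAverage_congr (fun s hs => rotatedCoeff_lead hQQ hQlead p hs j j) ht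

/-- Boundedness is what makes the real-valued `limsup` in `DetectableInDirection` more than a
default value. -/
theorem exists_abs_observability_le (hHm : ∀ i j, BddMeas fun t => H t i j)
    (hQ : IsContinuousQR A Q) (j : Fin k) :
    ∃ K, ∀ t, 0 < t → |observability H Q j t| ≤ K := by
  obtain ⟨_, K, hK⟩ := bddMeas_thinR hQ hHm j j
  refine ⟨K, fun t ht => ?_⟩
  have h := intervalIntegral.norm_integral_le_of_norm_le_const (a := 0) (b := t)
    (f := fun τ => thinR (observedBasis H Q τ) j j) (C := K) fun x hx => by
      rw [uIoc_of_le ht.le] at hx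
      exact hK x hx.1.le
  rw [sub_zero, abs_of_pos ht, Real.norm_eq_abs] at h
  rw [observability, timeAverage, abs_mul, abs_of_pos (by positivity), one_div,
    inv_mul_le_iff₀ ht]
  linarith

theorem observability_nonneg (j : Fin k) {t : ℝ} (ht : 0 ≤ t) : 0 ≤ observability H Q j t :=
  mul_nonneg (by positivity)
    (intervalIntegral.integral_nonneg ht fun _ _ => thinR_diag_nonneg _ j)

theorem errorCoeff_mulVec (p t : ℝ) (z x : Fin d → ℝ) :
    errorCoeff A H Q p t *ᵥ (z - x) =
      A t *ᵥ z - (A t *ᵥ x + gain H Q p t *ᵥ (H t *ᵥ z - H t *ᵥ x)) := by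
  rw [errorCoeff, sub_mulVec, mulVec_sub, ← mulVec_mulVec, mulVec_sub (H t)]
  abel

theorem detectable_of_decay (hAc : ∀ i j, ContinuousOn (fun t => A t i j) (Ici 0))
    (hAm : ∀ i j, BddMeas fun t => A t i j) (hHm : ∀ i j, BddMeas fun t => H t i j)
    (hΦ : IsFlow A Φ) (hQQ : IsContinuousQR A QQ) (hQ : IsContinuousQR A Q)
    (hQlead : ∀ t, 0 ≤ t → ∀ i j, Q t i j = QQ t i (Fin.castLE hkd j)) {p : ℝ} (hp : 0 < p)
    (hdec : ErrorDecaysExponentially A H (gain H Q p)) : Detectable A H Q := by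
  obtain ⟨C, hC, a, ha, hdec⟩ := hdec
  rintro j ⟨l, hl0, hl⟩
  have hT : UpperTriangular (rotatedCoeff A QQ (errorCoeff A H Q p)) :=
    upperTriangular_errorCoeff hQQ hQlead p
  have hCint : ∀ i l, LocInt fun t => rotatedCoeff A QQ (errorCoeff A H Q p) t i l := fun i l =>
    (bddMeas_rotatedCoeff hAm (bddMeas_errorCoeff hAm hQ hHm p) hQQ i l).locInt
  obtain ⟨η, hη0, hη⟩ := hT.exists_solvesLinear hCint (Pi.single (Fin.castLE hkd j) 1)
  have hξ := hη.mulVec hQQ hAc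
  set ξ := fun t => QQ t *ᵥ η t with hξdef
  have hz := hΦ.solvesLinear hAc (ξ 0)
  have hz0 : Φ 0 *ᵥ ξ 0 = ξ 0 := by rw [hΦ.1, one_mulVec]
  -- Every error trajectory is realised: with `z` the signal from `ξ 0`, the function `z - ξ` starts
  -- at `0` and solves the observer equation.
  have hbound := hdec (ξ 0) (fun t => Φ t *ᵥ ξ 0) (fun t => Φ t *ᵥ ξ 0 - ξ t)
    (isSolution_iff.2 ⟨hz0, hz⟩)
    (isSolution_iff.2 ⟨by rw [hz0, sub_self], fun i => ((hz i).sub (hξ i)).congr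
      (fun _ _ => rfl) fun t _ => by
        have h := errorCoeff_mulVec (A := A) (H := H) (Q := Q) p t (Φ t *ᵥ ξ 0)
          (Φ t *ᵥ ξ 0 - ξ t)
        rw [sub_sub_cancel] at h
        rw [h, Pi.sub_apply, sub_sub_cancel]⟩)
  simp only [sub_sub_cancel] at hbound
  have hexp : ∀ t, 0 ≤ t → Real.exp (∫ s in (0 : ℝ)..t, rotatedCoeff A QQ (errorCoeff A H Q p) s
      (Fin.castLE hkd j) (Fin.castLE hkd j)) ≤ C * Real.exp (-a * t) := by
    intro t ht
    have h1 := hη.eq_mul_exp hT hCint (j := Fin.castLE hkd j)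
      (fun m hm => by rw [hη0, Pi.single_eq_of_ne hm.ne']) ht
    rw [hη0, Pi.single_eq_same, one_mul] at h1
    rw [← h1]
    refine ((le_abs_self _).trans (abs_le_enorm2 _ _)).trans ?_
    have h2 := hbound t ht
    rwa [hξdef, enorm2_mulVec (hQQ t ht).1, enorm2_mulVec (hQQ 0 le_rfl).1, hη0, enorm2_single,
      mul_one] at h2
  -- Of the rate `a`, one quarter is lost to the average of `B_jj` and one quarter to `log C / t`.
  have hev : ∀ᶠ t in atTop, a / (2 * p) ≤ observability H Q j t := by
    filter_upwards [eventually_gt_atTop 0,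
      hl.eventually_const_lt (by linarith : l - a / 4 < l),
      (tendsto_const_div_add (Real.log C) (-a)).eventually_lt_const
        (by linarith : -a < -a + a / 4)] with t ht h1 h2
    have h3 := timeAverage_le_of_exp_le ht (hexp t ht.le)
    rw [timeAverage_rotatedCoeff_lead hAm hHm hQQ hQ hQlead p j ht.le] at h3
    rw [timeAverage_congr (fun s hs => coeffB_lead hQlead hs j) ht.le] at h1
    rw [div_le_iff₀ (by positivity)]
    nlinarith
  obtain ⟨K, hK⟩ := exists_abs_observability_le hHm hQ j
  have hbdd : IsBoundedUnder (· ≤ ·) atTop (observability H Q j) :=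
    isBoundedUnder_of_eventually_le (a := K) <| by
      filter_upwards [eventually_gt_atTop 0] with t ht
      exact (le_abs_self _).trans (hK t ht)
  have h1 : a / (2 * p) ≤ limsup (observability H Q j) atTop :=
    le_limsup_of_frequently_le hev.frequently hbdd
  exact lt_of_lt_of_le (by positivity) h1

theorem decay_of_diag_neg (hAc : ∀ i j, ContinuousOn (fun t => A t i j) (Ici 0))
    (hAm : ∀ i j, BddMeas fun t => A t i j) (hHm : ∀ i j, BddMeas fun t => H t i j)
    (hQQ : IsContinuousQR A QQ) (hQ : IsContinuousQR A Q)
    (hQlead : ∀ t, 0 ≤ t → ∀ i j, Q t i j = QQ t i (Fin.castLE hkd j)) (p : ℝ)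
    (hdiag : ∀ i, ∃ m < 0, Tendsto
      (timeAverage fun t => rotatedCoeff A QQ (errorCoeff A H Q p) t i i) atTop (𝓝 m)) :
    ErrorDecaysExponentially A H (gain H Q p) := by
  have hT : UpperTriangular (rotatedCoeff A QQ (errorCoeff A H Q p)) :=
    upperTriangular_errorCoeff hQQ hQlead p
  have hbm : ∀ i l, BddMeas fun t => rotatedCoeff A QQ (errorCoeff A H Q p) t i l := fun i l =>
    bddMeas_rotatedCoeff hAm (bddMeas_errorCoeff hAm hQ hHm p) hQQ i l
  choose M hM using fun i l => (hbm i l).2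
  have hM' : ∀ t, 0 ≤ t → ∀ i l,
      |rotatedCoeff A QQ (errorCoeff A H Q p) t i l| ≤ ∑ i, ∑ l, |M i l| := by
    intro t ht i l
    refine ((hM i l t ht).trans (le_abs_self _)).trans ?_
    refine (Finset.single_le_sum (f := fun l => |M i l|) (fun _ _ => abs_nonneg _)
      (Finset.mem_univ l)).trans ?_
    exact Finset.single_le_sum (f := fun i => ∑ l, |M i l|)
      (fun _ _ => Finset.sum_nonneg fun _ _ => abs_nonneg _) (Finset.mem_univ i)
  obtain ⟨K, hK, a, ha, h⟩ := hT.exists_decay (fun i l => (hbm i l).locInt) hM' hdiag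
  -- The `+ 1` only ensures positivity when `d * K = 0`.
  refine ⟨d * K + 1, by positivity, a, ha, fun v z x hz hx t ht => ?_⟩
  rw [isSolution_iff] at hz hx
  have hξ : SolvesLinear (errorCoeff A H Q p) fun t => z t - x t := fun i =>
    ((hz.2 i).sub (hx.2 i)).congr (fun _ _ => rfl) fun t _ => by
      rw [errorCoeff_mulVec, Pi.sub_apply]
  have hη := hξ.transpose_mulVec hQQ hAc
  have h1 := h _ (enorm2 (z 0 - x 0)) hη (fun i => by
    rw [← hQQ.enorm2_transpose_mulVec le_rfl]
    exact abs_le_enorm2 _ i) (enorm2_nonneg _) t ht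
  rw [← hQQ.enorm2_transpose_mulVec ht]
  calc enorm2 ((QQ t)ᵀ *ᵥ (z t - x t)) ≤ ∑ i, |((QQ t)ᵀ *ᵥ (z t - x t)) i| := enorm2_le_sum _
    _ ≤ ∑ _i : Fin d, K * Real.exp (-a * t) * enorm2 (z 0 - x 0) :=
        Finset.sum_le_sum fun i _ => h1 i
    _ = (d * K) * Real.exp (-a * t) * enorm2 (z 0 - x 0) := by simp; ring
    _ ≤ _ := by
        have := enorm2_nonneg (z 0 - x 0)
        gcongr
        linarith

end Observer

end LinearObserver

end

open LinearObserver in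
theorem mainTheorem2 {d k s : ℕ} (hkd : k ≤ d)
    (A : ℝ → Matrix (Fin d) (Fin d) ℝ) (H : ℝ → Matrix (Fin s) (Fin d) ℝ)
    (hAcont : ∀ i j, ContinuousOn (fun t => A t i j) (Set.Ici 0))
    (hHmeas : ∀ i j, Measurable fun t => H t i j)
    (hA : BoundedInTime A) (hH : BoundedInTime H)
    -- the flow, the Lyapunov exponents, and the number `k` of non-negative ones
    (Φ : ℝ → Matrix (Fin d) (Fin d) ℝ) (hΦ : IsFlow A Φ)
    (lam : Fin d → ℝ) (hlam : IsLyapunovSpectrum Φ lam)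
    (hk : k = (Finset.univ.filter fun i => 0 ≤ lam i).card)
    -- the full and the thin continuous QR factors, and forward regularity
    (QQ : ℝ → Matrix (Fin d) (Fin d) ℝ) (hQQ : IsContinuousQR A QQ)
    (hreg : ForwardRegular A QQ)
    (Q : ℝ → Matrix (Fin d) (Fin k) ℝ) (hQ : IsContinuousQR A Q)
    (hQlead : ∀ t, 0 ≤ t → ∀ i j, Q t i j = QQ t i (Fin.castLE hkd j))
    -- the span of the initial columns is transversal to the stable subspace
    (hQ0 : ∀ u : Fin k → ℝ, u ≠ 0 → 0 ≤ lyapunovExponent Φ (Q 0 *ᵥ u)) :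
    ((∃ p : ℝ, 0 < p ∧ ErrorDecaysExponentially A H (gain H Q p)) → Detectable A H Q) ∧
    ((∀ j, ∃ c : ℝ, Filter.Tendsto (observability H Q j) Filter.atTop (nhds c)) →
      ((∃ p : ℝ, 0 < p ∧ ErrorDecaysExponentially A H (gain H Q p)) ↔ Detectable A H Q)) := by
  have hAm : ∀ i j, BddMeas fun t => A t i j := fun i j =>
    ⟨(hAcont i j).aemeasurable measurableSet_Ici, hA.exists_abs_le i j⟩
  have hHm : ∀ i j, BddMeas fun t => H t i j := fun i j =>
    ⟨(hHmeas i j).aemeasurable, hH.exists_abs_le i j⟩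
  have hnec : (∃ p : ℝ, 0 < p ∧ ErrorDecaysExponentially A H (gain H Q p)) → Detectable A H Q :=
    fun ⟨p, hp, h⟩ => detectable_of_decay hAcont hAm hHm hΦ hQQ hQ hQlead hp h
  refine ⟨hnec, fun hobs => ⟨hnec, fun hdet => ?_⟩⟩
  choose b hb using hreg
  choose r hr using hobs
  have hr0 : ∀ j, 0 ≤ r j := fun j =>
    ge_of_tendsto (hr j) ((eventually_ge_atTop 0).mono fun t ht => observability_nonneg j ht)
  have hrpos : ∀ j, 0 ≤ b (Fin.castLE hkd j) → 0 < r j := by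
    intro j hj
    rw [← (hr j).limsup_eq]
    refine hdet j ⟨_, hj, (hb (Fin.castLE hkd j)).congr' ?_⟩
    filter_upwards [eventually_ge_atTop 0] with t ht
    exact (timeAverage_congr (fun s hs => coeffB_lead hQlead hs j) ht).symm
  obtain ⟨p, hp, hpb⟩ : ∃ p : ℝ, 0 < p ∧ ∀ j, b (Fin.castLE hkd j) - p * r j < 0 := by
    -- If `b_j ≥ 0`, then `r_j > 0` and `p r_j ≥ r_j + b_j`. If `b_j < 0`, then `r_j ≥ 0` suffices,
    -- and a zero `r_j` contributes `0` to the sum.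
    refine ⟨1 + ∑ j, |b (Fin.castLE hkd j)| / r j,
      add_pos_of_pos_of_nonneg one_pos
        (Finset.sum_nonneg fun j _ => div_nonneg (abs_nonneg _) (hr0 j)), fun j => ?_⟩
    have hle := Finset.single_le_sum (f := fun j => |b (Fin.castLE hkd j)| / r j)
      (fun j _ => div_nonneg (abs_nonneg _) (hr0 j)) (Finset.mem_univ j)
    rcases lt_or_ge (b (Fin.castLE hkd j)) 0 with hneg | hnn
    · have h0 := div_nonneg (abs_nonneg (b (Fin.castLE hkd j))) (hr0 j)
      nlinarith [hr0 j]
    · have hpos := hrpos j hnn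
      have h1 : |b (Fin.castLE hkd j)| / r j * r j = b (Fin.castLE hkd j) := by
        rw [div_mul_cancel₀ _ hpos.ne', abs_of_nonneg hnn]
      nlinarith
  refine ⟨p, hp, decay_of_diag_neg hAcont hAm hHm hQQ hQ hQlead p fun i => ?_⟩
  by_cases hi : (i : ℕ) < k
  · obtain ⟨j, rfl⟩ : ∃ j : Fin k, i = Fin.castLE hkd j := ⟨⟨i, hi⟩, rfl⟩
    refine ⟨_, hpb j, ((hb (Fin.castLE hkd j)).sub ((hr j).const_mul p)).congr' ?_⟩
    filter_upwards [eventually_ge_atTop 0] with t ht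
    exact (timeAverage_rotatedCoeff_lead hAm hHm hQQ hQ hQlead p j ht).symm
  · have hki := not_lt.1 hi
    refine ⟨b i, tail_average_neg hΦ hAcont hAm hQQ hlam hk hQ hQlead hQ0 hki (hb i),
      (hb i).congr' ?_⟩
    filter_upwards [eventually_ge_atTop 0] with t ht
    exact (timeAverage_congr (fun s hs => rotatedCoeff_tail hQQ hQlead p hs hki i) ht).symm
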